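/- Let $\hbar>0$. A continuous-time Page--Wootters (PW) system on a complex Hilbert space $\mathcal H$ consists of: an ideal clock, that is, a Hilbert space $\mathcal H_c$ with a unitary identification $\mathcal H_c\cong L^2(\mathbb R,d\tau)$, under which the time operator $T_c$ is multiplication by $\tau$ and the clock Hamiltonian is $H_c=-i\hbar\,\frac{d}{d\tau}$ (both self-adjoint, with their maximal domains); a separable Hilbert space $\mathcal H_r$ with a (possibly unbounded) self-adjoint operator $H_r$; and a tensor product structure (TPS), i.e. a unitary isomorphism $\mathcal U:\mathcal H_c\otimes\mathcal H_r\to\mathcal H$. Its total Hamiltonian is $H=\mathcal U\,(H_c\otimes I_r+I_c\otimes H_r)\,\mathcal U^{-1}$. Here tensor products of Hilbert spaces are completed, and tensor products and sums of unbounded operators are understood as the closures of the operators defined on the natural domains. **Proposition.** For any such PW system let $S=e^{\frac{i}{\hbar}T_c\otimes H_r}$, a unitary operator on $\mathcal H_c\otimes\mathcal H_r$ (the value at $t=1/\hbar$ of the strongly continuous unitary group $e^{itT_c\otimes H_r}$ generated by $T_c\otimes H_r$). Then $$S\,(H_c\otimes I_r+I_c\otimes H_r)\,S^{-1}=H_c\otimes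 I_r ,$$ as an equality of unbounded operators, domains included. Consequently, in the TPS $\mathcal U'=\mathcal U\circ S^{-1}$, whose factors $\mathcal H_{c'}$, $\mathcal H_{r'}$ are copies of $\mathcal H_c$, $\mathcal H_r$ with $H_{c'}=H_c$, the same total Hamiltonian reads $$H=\mathcal U'\,(H_{c'}\otimes I_{r'})\,\mathcal U'^{-1},$$ that is, it is the total Hamiltonian of the PW system on $\mathcal H$ with TPS $\mathcal U'$, the ideal clock $c'$ and world Hamiltonian $H_{r'}=0$. Moreover $\mathcal U'\neq\mathcal U$ whenever $H_r\neq0$. -/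

import Mathlib

open MeasureTheory
open scoped TensorProduct ContDiff

noncomputable section

namespace PageWootters

/-! ### Hilbert tensor products and unbounded operators on them -/

section Operators

variable {E F : Type*} [NormedAddCommGroup E] [InnerProductSpace ℂ E]
  [NormedAddCommGroup F] [InnerProductSpace ℂ F]

/-- The Hilbert space tensor product: the completion of the algebraic tensor product for
the inner product with `⟪x ⊗ y, x' ⊗ y'⟫ = ⟪x, x'⟫ * ⟪y, y'⟫`. -/
abbrev HilbertTensor (E F : Type*) [NormedAddCommGroup E] [InnerProductSpace ℂ E]
    [NormedAddCommGroup F] [InnerProductSpace ℂ F] : Type _ :=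
  UniformSpace.Completion (E ⊗[ℂ] F)

/-- The product vector `x ⊗ y` in the Hilbert tensor product. -/
def prodVec (x : E) (y : F) : HilbertTensor E F := ((x ⊗ₜ[ℂ] y : E ⊗[ℂ] F) : HilbertTensor E F)

/-- The identity operator, with domain the whole space. -/
def idOp (E : Type*) [NormedAddCommGroup E] [InnerProductSpace ℂ E] : E →ₗ.[ℂ] E :=
  (LinearMap.id : E →ₗ[ℂ] E).toPMap ⊤

/-- The graph of the algebraic tensor product of `A` and `B`: the linear span of the pairs
`(x ⊗ y, A x ⊗ B y)` with `x` in the domain of `A` and `y` in the domain of `B`. -/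
def tensorGraph (A : E →ₗ.[ℂ] E) (B : F →ₗ.[ℂ] F) :
    Submodule ℂ (HilbertTensor E F × HilbertTensor E F) :=
  Submodule.span ℂ {p | ∃ (x : A.domain) (y : B.domain),
    p = (prodVec (x : E) (y : F), prodVec (A x) (B y))}

/-- The operator `A ⊗ B` on the Hilbert tensor product: the closure of the algebraic tensor
product of the two operators (the one whose graph is the closure of `tensorGraph A B`; see
`tensorOp_graph`). -/
def tensorOp (A : E →ₗ.[ℂ] E) (B : F →ₗ.[ℂ] F) : HilbertTensor E F →ₗ.[ℂ] HilbertTensor E F :=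
  (tensorGraph A B).topologicalClosure.toLinearPMap

/-- `A ⊗ I + I ⊗ B`: the closure of the sum of the operators `A ⊗ I` and `I ⊗ B` (the sum being
defined on the intersection of the two domains). -/
def nonInteracting (A : E →ₗ.[ℂ] E) (B : F →ₗ.[ℂ] F) :
    HilbertTensor E F →ₗ.[ℂ] HilbertTensor E F :=
  (tensorOp A (idOp F) + tensorOp (idOp E) B).closure

/-- The operator `U A U⁻¹`, with domain `U (dom A)`. -/
def conj (U : E ≃ₗᵢ[ℂ] F) (A : E →ₗ.[ℂ] E) : F →ₗ.[ℂ] F where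
  domain := A.domain.comap U.symm.toLinearEquiv.toLinearMap
  toFun := U.toLinearEquiv.toLinearMap ∘ₗ A.toFun ∘ₗ
    U.symm.toLinearEquiv.toLinearMap.submoduleComap A.domain

/-- `W t = exp (i t A)`: `W` is a strongly continuous one-parameter group of unitary operators
and `A` is its generator in the sense of Stone's theorem. -/
structure IsUnitaryGroupOf (A : E →ₗ.[ℂ] E) (W : ℝ → E ≃ₗᵢ[ℂ] E) : Prop where
  map_zero : W 0 = LinearIsometryEquiv.refl ℂ E
  map_add : ∀ s t : ℝ, W (s + t) = (W t).trans (W s)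
  continuous : ∀ x : E, Continuous fun t : ℝ => W t x
  generator : ∀ x y : E,
    (x, y) ∈ A.graph ↔ HasDerivAt (fun t : ℝ => W t x) (Complex.I • y) 0

/-- `U = exp (i t A)` for the (possibly unbounded) operator `A`. -/
def IsExp (t : ℝ) (A : E →ₗ.[ℂ] E) (U : E ≃ₗᵢ[ℂ] E) : Prop :=
  ∃ W : ℝ → E ≃ₗᵢ[ℂ] E, IsUnitaryGroupOf A W ∧ U = W t

theorem inner_prodVec (x x' : E) (y y' : F) :
    inner ℂ (prodVec x y) (prodVec x' y') = inner ℂ x x' * inner ℂ y y' := by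
  rw [prodVec, prodVec, UniformSpace.Completion.inner_coe, TensorProduct.inner_tmul]

theorem continuous_prodVec : Continuous fun p : E × F => prodVec p.1 p.2 :=
  (UniformSpace.Completion.continuous_coe _).comp TensorProduct.continuous_tmul

theorem eq_zero_of_inner_prodVec {D : Submodule ℂ E} {D' : Submodule ℂ F}
    (hD : Dense (D : Set E)) (hD' : Dense (D' : Set F)) (w : HilbertTensor E F)
    (hw : ∀ x ∈ D, ∀ y ∈ D', inner ℂ (prodVec x y) w = 0) : w = 0 := by
  have h1 : ∀ p : E × F, inner ℂ (prodVec p.1 p.2) w = 0 := by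
    intro p
    have hc : IsClosed {p : E × F | inner ℂ (prodVec p.1 p.2) w = 0} :=
      isClosed_eq (continuous_prodVec.inner continuous_const) continuous_const
    have hd := hD.prod hD'
    have : closure ((D : Set E) ×ˢ (D' : Set F)) ⊆
        {p : E × F | inner ℂ (prodVec p.1 p.2) w = 0} :=
      closure_minimal (fun q hq => hw _ hq.1 _ hq.2) hc
    exact this (hd p)
  have h2 : ∀ v : E ⊗[ℂ] F, inner ℂ (v : HilbertTensor E F) w = 0 := by
    intro v
    induction v using TensorProduct.induction_on with
    | zero => rw [UniformSpace.Completion.coe_zero, inner_zero_left]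
    | tmul x y => exact h1 (x, y)
    | add a b ha hb => rw [UniformSpace.Completion.coe_add, inner_add_left, ha, hb, add_zero]
  have h3 : ∀ v : HilbertTensor E F, inner ℂ v w = 0 := by
    intro v
    induction v using UniformSpace.Completion.induction_on with
    | hp => exact isClosed_eq (continuous_id.inner continuous_const) continuous_const
    | ih a => exact h2 a
  exact inner_self_eq_zero.mp (h3 w)

theorem snd_eq_zero_of_mem_closure_tensorGraph {A : E →ₗ.[ℂ] E} {B : F →ₗ.[ℂ] F}
    (hA : Dense (A.domain : Set E)) (hB : Dense (B.domain : Set F))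
    (hA' : A.IsFormalAdjoint A) (hB' : B.IsFormalAdjoint B) (p : HilbertTensor E F × HilbertTensor E F)
    (hp : p ∈ (tensorGraph A B).topologicalClosure) (hp0 : p.1 = 0) : p.2 = 0 := by
  refine eq_zero_of_inner_prodVec hA hB _ fun x hx y hy => ?_
  have key : inner ℂ (prodVec x y) p.2 =
      inner ℂ (prodVec (A ⟨x, hx⟩) (B ⟨y, hy⟩)) p.1 := by
    have hc : IsClosed {q : HilbertTensor E F × HilbertTensor E F |
        inner ℂ (prodVec x y) q.2 = inner ℂ (prodVec (A ⟨x, hx⟩) (B ⟨y, hy⟩)) q.1} :=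
      isClosed_eq (continuous_const.inner continuous_snd) (continuous_const.inner continuous_fst)
    have hs : (tensorGraph A B : Set (HilbertTensor E F × HilbertTensor E F)) ⊆ {q |
        inner ℂ (prodVec x y) q.2 = inner ℂ (prodVec (A ⟨x, hx⟩) (B ⟨y, hy⟩)) q.1} := by
      intro q hq
      induction hq using Submodule.span_induction with
      | mem q hq =>
        obtain ⟨u, v, rfl⟩ := hq
        simp only [Set.mem_ofPred_eq, inner_prodVec]
        rw [hA' ⟨x, hx⟩ u, hB' ⟨y, hy⟩ v]
      | zero => simp
      | add a b _ _ ha hb =>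
        simp only [Set.mem_ofPred_eq, Prod.fst_add, Prod.snd_add, inner_add_right] at *
        rw [ha, hb]
      | smul c a _ ha =>
        simp only [Set.mem_ofPred_eq, Prod.smul_fst, Prod.smul_snd, inner_smul_right] at *
        rw [ha]
    exact closure_minimal hs hc hp
  rw [key, hp0, inner_zero_right]

/-- For densely defined symmetric operators `A ⊗ B` really is the closure of the algebraic
tensor product. -/
theorem tensorOp_graph {A : E →ₗ.[ℂ] E} {B : F →ₗ.[ℂ] F}
    (hA : Dense (A.domain : Set E)) (hB : Dense (B.domain : Set F))
    (hA' : A.IsFormalAdjoint A) (hB' : B.IsFormalAdjoint B) :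
    (tensorOp A B).graph = (tensorGraph A B).topologicalClosure :=
  Submodule.toLinearPMap_graph_eq _
    fun p hp hp0 => snd_eq_zero_of_mem_closure_tensorGraph hA hB hA' hB' p hp hp0

end Operators

/-! ### Ideal clocks -/

section Clock

/-- The Hilbert space `L²(ℝ)`. -/
abbrev L2R : Type := Lp ℂ 2 (volume : Measure ℝ)

/-- Multiplication by `τ` on `L²(ℝ)`, with its maximal domain. -/
def mulTau : L2R →ₗ.[ℂ] L2R where
  domain :=
    { carrier := {f | MemLp (fun τ : ℝ => (τ : ℂ) * f τ) 2 volume}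
      zero_mem' := by
        refine (MemLp.zero' (p := 2) (μ := (volume : Measure ℝ)) (ε := ℂ)).ae_eq ?_
        filter_upwards [Lp.coeFn_zero ℂ 2 (volume : Measure ℝ)] with τ h
        simp only [h, Pi.zero_apply, mul_zero]
      add_mem' := by
        intro f g hf hg
        refine (MemLp.add hf hg).ae_eq ?_
        filter_upwards [Lp.coeFn_add f g] with τ h
        simp only [h, Pi.add_apply, mul_add]
      smul_mem' := by
        intro c f hf
        refine (MemLp.const_smul hf c).ae_eq ?_
        filter_upwards [Lp.coeFn_smul c f] with τ h
        simp only [h, Pi.smul_apply, smul_eq_mul, mul_left_comm] }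
  toFun :=
    { toFun := fun f => MemLp.toLp (fun τ : ℝ => (τ : ℂ) * (f : L2R) τ) f.2
      map_add' := by
        intro f g
        rw [← MemLp.toLp_add, MemLp.toLp_eq_toLp_iff]
        filter_upwards [Lp.coeFn_add (f : L2R) (g : L2R)] with τ h
        simp only [Submodule.coe_add, h, Pi.add_apply, mul_add]
      map_smul' := by
        intro c f
        rw [RingHom.id_apply, ← MemLp.toLp_const_smul, MemLp.toLp_eq_toLp_iff]
        filter_upwards [Lp.coeFn_smul c (f : L2R)] with τ h
        simp only [Submodule.coe_smul, h, Pi.smul_apply, smul_eq_mul, mul_left_comm] }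

theorem integrable_smul_L2R {φ : ℝ → ℝ} (hφ : Continuous φ) (hs : HasCompactSupport φ) (f : L2R) :
    Integrable (fun τ => φ τ • f τ) := by
  have h1 : LocallyIntegrable (f : ℝ → ℂ) volume := (Lp.memLp f).locallyIntegrable (by norm_num)
  exact h1.integrable_smul_left_of_hasCompactSupport hφ hs

/-- The graph of `-iħ d/dτ` on `L²(ℝ)`, the derivative being taken in the weak sense:
`g = -iħ f'` means that `∫ φ g = iħ ∫ φ' f` for all test functions `φ`. -/
def momentumGraph (ħ : ℝ) : Submodule ℂ (L2R × L2R) where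
  carrier := {p | ∀ φ : ℝ → ℝ, ContDiff ℝ ∞ φ → HasCompactSupport φ →
    ∫ τ, φ τ • p.2 τ = Complex.I * ħ * ∫ τ, deriv φ τ • p.1 τ}
  zero_mem' := by
    intro φ _ _
    have h1 : (fun τ => φ τ • (0 : L2R) τ) =ᵐ[volume] fun _ => (0 : ℂ) := by
      filter_upwards [Lp.coeFn_zero ℂ 2 (volume : Measure ℝ)] with τ h
      simp only [h, Pi.zero_apply, smul_zero]
    have h2 : (fun τ => deriv φ τ • (0 : L2R) τ) =ᵐ[volume] fun _ => (0 : ℂ) := by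
      filter_upwards [Lp.coeFn_zero ℂ 2 (volume : Measure ℝ)] with τ h
      simp only [h, Pi.zero_apply, smul_zero]
    simp only [Prod.fst_zero, Prod.snd_zero]
    rw [integral_congr_ae h1, integral_congr_ae h2]
    simp
  add_mem' := by
    intro p q hp hq φ h1 h2
    have e : ∀ (ψ : ℝ → ℝ), Continuous ψ → HasCompactSupport ψ → ∀ f g : L2R,
        ∫ τ, ψ τ • (f + g : L2R) τ = (∫ τ, ψ τ • f τ) + ∫ τ, ψ τ • g τ := by
      intro ψ c s f g
      rw [← integral_add (integrable_smul_L2R c s f) (integrable_smul_L2R c s g)]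
      refine integral_congr_ae ?_
      filter_upwards [Lp.coeFn_add f g] with τ h
      simp only [h, Pi.add_apply, smul_add]
    simp only [Prod.fst_add, Prod.snd_add]
    rw [e φ h1.continuous h2, e _ (h1.continuous_deriv (by simp)) h2.deriv,
      hp φ h1 h2, hq φ h1 h2, mul_add]
  smul_mem' := by
    intro c p hp φ h1 h2
    have e : ∀ (ψ : ℝ → ℝ) (f : L2R),
        ∫ τ, ψ τ • (c • f : L2R) τ = c * ∫ τ, ψ τ • f τ := by
      intro ψ f
      rw [← integral_const_mul]
      refine integral_congr_ae ?_
      filter_upwards [Lp.coeFn_smul c f] with τ h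
      simp only [h, Pi.smul_apply, smul_eq_mul, Complex.real_smul, mul_left_comm]
    simp only [Prod.smul_fst, Prod.smul_snd]
    rw [e, e, hp φ h1 h2, mul_left_comm]

/-- The operator `-iħ d/dτ` on `L²(ℝ)`, with domain the functions whose weak derivative is
in `L²(ℝ)`. -/
def momentum (ħ : ℝ) : L2R →ₗ.[ℂ] L2R := (momentumGraph ħ).toLinearPMap

theorem momentum_graph (ħ : ℝ) : (momentum ħ).graph = momentumGraph ħ := by
  refine Submodule.toLinearPMap_graph_eq _ fun p hp hp0 => ?_
  have h1 : LocallyIntegrable (p.2 : ℝ → ℂ) volume :=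
    (Lp.memLp p.2).locallyIntegrable (by norm_num)
  have h2 : ∀ᵐ τ ∂(volume : Measure ℝ), (p.2 : ℝ → ℂ) τ = 0 := by
    refine ae_eq_zero_of_integral_contDiff_smul_eq_zero h1 fun φ c s => ?_
    rw [hp φ c s, hp0]
    have h3 : (fun τ => deriv φ τ • (0 : L2R) τ) =ᵐ[volume] fun _ => (0 : ℂ) := by
      filter_upwards [Lp.coeFn_zero ℂ 2 (volume : Measure ℝ)] with τ h
      simp only [h, Pi.zero_apply, smul_zero]
    rw [integral_congr_ae h3]
    simp
  exact (Lp.eq_zero_iff_ae_eq_zero).mpr h2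

/-- An ideal clock with Hilbert space `Hc`: an identification of `Hc` with `L²(ℝ)`, under which
a state `ψ` is given by its clock readings `τ ↦ ⟨τ|ψ⟩`. -/
structure IdealClock (Hc : Type*) [NormedAddCommGroup Hc] [InnerProductSpace ℂ Hc] where
  reading : Hc ≃ₗᵢ[ℂ] L2R

variable {Hc : Type*} [NormedAddCommGroup Hc] [InnerProductSpace ℂ Hc]

/-- The time operator `∫ τ |τ⟩⟨τ| dτ`. -/
def IdealClock.timeOp (c : IdealClock Hc) : Hc →ₗ.[ℂ] Hc := conj c.reading.symm mulTau

/-- The clock Hamiltonian `-iħ d/dτ`. -/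
def IdealClock.hamiltonian (c : IdealClock Hc) (ħ : ℝ) : Hc →ₗ.[ℂ] Hc :=
  conj c.reading.symm (momentum ħ)

end Clock

/-! ### Tensor product structures and Page-Wootters systems -/

section Systems

/-- A tensor product structure on `H` with factors `Hc` and `Hr`: a unitary isomorphism from
the Hilbert tensor product onto `H`. -/
abbrev TPS (Hc Hr H : Type*) [NormedAddCommGroup Hc] [InnerProductSpace ℂ Hc]
    [NormedAddCommGroup Hr] [InnerProductSpace ℂ Hr]
    [NormedAddCommGroup H] [InnerProductSpace ℂ H] : Type _ :=
  HilbertTensor Hc Hr ≃ₗᵢ[ℂ] H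

/-- A (continuous-time) Page-Wootters system on the Hilbert space `H`: a decomposition of `H`
into an ideal clock and the rest of the world, and a Hamiltonian of the rest of the world. -/
structure PWSystem (Hc Hr H : Type*) [NormedAddCommGroup Hc] [InnerProductSpace ℂ Hc]
    [NormedAddCommGroup Hr] [InnerProductSpace ℂ Hr] [CompleteSpace Hr]
    [NormedAddCommGroup H] [InnerProductSpace ℂ H] where
  tps : TPS Hc Hr H
  clock : IdealClock Hc
  worldHamiltonian : Hr →ₗ.[ℂ] Hr
  selfAdjoint : IsSelfAdjoint worldHamiltonian

/-- The total Hamiltonian `H_c ⊗ I + I ⊗ H_r`, carried to `H` by the tensor product structure: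
the two subsystems do not interact. -/
def PWSystem.totalHamiltonian {Hc Hr H : Type*} [NormedAddCommGroup Hc] [InnerProductSpace ℂ Hc]
    [NormedAddCommGroup Hr] [InnerProductSpace ℂ Hr] [CompleteSpace Hr]
    [NormedAddCommGroup H] [InnerProductSpace ℂ H] (P : PWSystem Hc Hr H) (ħ : ℝ) :
    H →ₗ.[ℂ] H :=
  conj P.tps (nonInteracting (P.clock.hamiltonian ħ) P.worldHamiltonian)

end Systems

end PageWootters

end

noncomputable section

namespace PageWootters

/-! ### Adjoints of linear relations and essential self-adjointness -/

section Graphs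

variable {E F : Type*} [NormedAddCommGroup E] [InnerProductSpace ℂ E]
  [NormedAddCommGroup F] [InnerProductSpace ℂ F]

/-! Write `A` for the world Hamiltonian and `V s = exp (i s A)` for its unitary group. The Hilbert
tensor product of the clock space with the rest is `L²(ℝ; Hr)`, with `x ⊗ y` corresponding to `τ ↦
x(τ) y` (`exists_vectorReading`). There `T_c ⊗ A` is the fibrewise operator `τ A`, so it generates
`u ↦ (τ ↦ V (tτ) (u τ))` (`isUnitaryGroupOf_interaction`), and `S` is the case `t = 1/ħ`. For a test
function `φ` and `y` in the domain of `A`, `S⁻¹ (φ ⊗ y)` is `τ ↦ φ(τ) V (-τ/ħ) y`. By the product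
rule `-iħ d/dτ` sends it to `S⁻¹ (H_c φ ⊗ y) - S⁻¹ (φ ⊗ A y)` (`interaction_mem_graph_hamiltonian`).
Since `V` commutes with `A`, the operator `I ⊗ A` sends it to `S⁻¹ (φ ⊗ A y)`
(`interaction_mem_graph_idOp_tensorOp`). The two terms in `A` cancel, so on these vectors the sum
acts as `S⁻¹ (H_c ⊗ I) S`. Domains are settled by essential self-adjointness. The vectors `φ ⊗ y`
form a core of `H_c ⊗ I`, hence their images under `S⁻¹` form a core of `S⁻¹ (H_c ⊗ I) S`. The sum
`H_c ⊗ I + I ⊗ A` is a symmetric extension of the restriction to that core, and such an extension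
has the same closure (`closure_eq_of_le_graph`). Essential self-adjointness is always obtained from
one criterion, `topologicalClosure_eq_adjoint`, applied to graphs as linear relations, so that an
adjoint is available without density of a domain. The existence of `V` is the hard half of Stone's
theorem, proved by Yosida approximation (`exists_isUnitaryGroupOf`). Finally `S = 1` would make `V`
trivial and `A = 0`, which gives the inequality of the two tensor product structures. -/

theorem mem_adjoint {D : Submodule ℂ (E × E)} {p : E × E} :
    p ∈ D.adjoint ↔ ∀ q ∈ D, inner ℂ q.2 p.1 = inner ℂ q.1 p.2 := by
  simp only [Submodule.mem_adjoint_iff, Prod.forall, sub_eq_zero]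

theorem mem_adjoint_span {s : Set (E × E)} {p : E × E} :
    p ∈ (Submodule.span ℂ s).adjoint ↔ ∀ q ∈ s, inner ℂ q.2 p.1 = inner ℂ q.1 p.2 := by
  rw [mem_adjoint]
  refine ⟨fun h q hq => h q (Submodule.subset_span hq), fun h q hq => ?_⟩
  induction hq using Submodule.span_induction with
  | mem q hq => exact h q hq
  | zero => simp
  | add a b _ _ ha hb => simp only [Prod.fst_add, Prod.snd_add, inner_add_left, ha, hb]
  | smul c a _ ha => simp only [Prod.smul_fst, Prod.smul_snd, inner_smul_left, ha]

theorem isClosed_adjoint (D : Submodule ℂ (E × E)) : IsClosed (D.adjoint : Set (E × E)) := by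
  have : (D.adjoint : Set (E × E)) =
      ⋂ q ∈ D, {p : E × E | inner ℂ q.2 p.1 = inner ℂ q.1 p.2} := by
    ext p
    simp only [SetLike.mem_coe, mem_adjoint, Set.mem_iInter, Set.mem_ofPred_eq]
  rw [this]
  exact isClosed_biInter fun q _ => isClosed_eq (continuous_const.inner continuous_fst)
    (continuous_const.inner continuous_snd)

theorem adjoint_antitone {D D' : Submodule ℂ (E × E)} (h : D ≤ D') : D'.adjoint ≤ D.adjoint :=
  fun _ hp => mem_adjoint.2 fun q hq => mem_adjoint.1 hp q (h hq)

theorem le_adjoint_comm {D D' : Submodule ℂ (E × E)} (h : D ≤ D'.adjoint) : D' ≤ D.adjoint :=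
  fun p hp => mem_adjoint.2 fun q hq => by
    rw [← inner_conj_symm, ← inner_conj_symm q.1, mem_adjoint.1 (h hq) p hp]

theorem adjoint_topologicalClosure (D : Submodule ℂ (E × E)) :
    D.topologicalClosure.adjoint = D.adjoint :=
  le_antisymm (adjoint_antitone D.le_topologicalClosure)
    (le_adjoint_comm (D.topologicalClosure_minimal (le_adjoint_comm le_rfl) (isClosed_adjoint _)))

/-- A symmetric relation whose adjoint has trivial deficiency spaces is essentially
self-adjoint. -/
theorem topologicalClosure_eq_adjoint [CompleteSpace E] {D : Submodule ℂ (E × E)}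
    (hD : D ≤ D.adjoint)
    (h0 : ∀ u v : E, (u, v) ∈ D.adjoint → (v, -u) ∈ D.adjoint → u = 0 ∧ v = 0) :
    D.topologicalClosure = D.adjoint := by
  have hle : D.topologicalClosure ≤ D.adjoint :=
    D.topologicalClosure_minimal hD (isClosed_adjoint _)
  refine le_antisymm hle fun p hp => ?_
  -- The product `E × E` carries the sup norm; `WithLp 2` gives it the inner product needed to
  -- project orthogonally onto the closure of `D`.
  let e : WithLp 2 (E × E) ≃L[ℂ] E × E := WithLp.prodContinuousLinearEquiv 2 ℂ E E
  let K : Submodule ℂ (WithLp 2 (E × E)) :=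
    D.topologicalClosure.comap (e : WithLp 2 (E × E) →ₗ[ℂ] E × E)
  have hK : IsClosed (K : Set (WithLp 2 (E × E))) :=
    D.isClosed_topologicalClosure.preimage e.continuous
  have : CompleteSpace K := hK.completeSpace_coe
  obtain ⟨q, hq, r, hr, hqr⟩ := K.exists_add_mem_mem_orthogonal (e.symm p)
  have hp' : p = e q + e r := by
    rw [← map_add, ← hqr, e.apply_symm_apply]
  have hr1 : e r ∈ D.adjoint := by
    have : e r = p - e q := by rw [hp']; abel
    rw [this]
    exact sub_mem hp (hle hq)
  -- Orthogonality of `(r₁, r₂)` to a graph is membership of the rotated pair `(r₂, -r₁)` in the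
  -- adjoint. So the orthogonal component `r` satisfies both hypotheses of `h0` and vanishes.
  have hr2 : ((e r).2, -(e r).1) ∈ D.adjoint := by
    refine mem_adjoint.2 fun d hd => ?_
    have h1 := (K.mem_orthogonal r).1 hr (e.symm d) (by
      change e (e.symm d) ∈ D.topologicalClosure
      rw [e.apply_symm_apply]
      exact D.le_topologicalClosure hd)
    have h2 : inner ℂ d.1 (e r).1 + inner ℂ d.2 (e r).2 = 0 := h1
    rw [inner_neg_right]
    exact eq_neg_of_add_eq_zero_right h2
  have h := h0 (e r).1 (e r).2 hr1 hr2
  have hr0 : e r = 0 := Prod.ext h.1 h.2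
  rw [hp', hr0, add_zero]
  exact hq

theorem mem_graph_conj {U : E ≃ₗᵢ[ℂ] F} {A : E →ₗ.[ℂ] E} {p : F × F} :
    p ∈ (conj U A).graph ↔ (U.symm p.1, U.symm p.2) ∈ A.graph := by
  obtain ⟨x, y⟩ := p
  simp only [LinearPMap.mem_graph_iff]
  constructor
  · rintro ⟨⟨z, hz⟩, rfl, h⟩
    refine ⟨⟨U.symm z, hz⟩, rfl, ?_⟩
    apply U.injective
    rw [U.apply_symm_apply]
    exact h
  · rintro ⟨⟨z, hz⟩, h1, h2⟩
    simp only at h1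
    subst h1
    refine ⟨⟨x, hz⟩, rfl, ?_⟩
    change U (A ⟨U.symm x, hz⟩) = y
    rw [h2, U.apply_symm_apply]

theorem graph_adjoint_of_isSelfAdjoint [CompleteSpace E] {A : E →ₗ.[ℂ] E}
    (hA : IsSelfAdjoint A) : A.graph.adjoint = A.graph := by
  rw [← LinearPMap.adjoint_graph_eq_graph_adjoint hA.dense_domain,
    LinearPMap.isSelfAdjoint_def.1 hA]

theorem inner_graph_comm [CompleteSpace E] {A : E →ₗ.[ℂ] E} (hA : IsSelfAdjoint A) {p q : E × E}
    (hp : p ∈ A.graph) (hq : q ∈ A.graph) : inner ℂ q.2 p.1 = inner ℂ q.1 p.2 := by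
  rw [← graph_adjoint_of_isSelfAdjoint hA] at hp
  exact mem_adjoint.1 hp q hq

end Graphs

/-! ### Resolvents and Yosida approximation of a self-adjoint operator -/

section Stone

variable {E : Type*} [NormedAddCommGroup E] [InnerProductSpace ℂ E] [CompleteSpace E]
  {A : E →ₗ.[ℂ] E}

/-- The cross term drops out because `⟪A x, x⟫` is real. This bounds `A + i l` from below, hence
gives both uniqueness and the norm bound for the resolvent. -/
theorem norm_sq_add_I_smul (hA : IsSelfAdjoint A) (l : ℝ) {p : E × E} (hp : p ∈ A.graph) :
    ‖p.2 + (Complex.I * l) • p.1‖ ^ 2 = ‖p.2‖ ^ 2 + l ^ 2 * ‖p.1‖ ^ 2 := by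
  have h := inner_graph_comm hA hp hp
  rw [@norm_add_sq ℂ, inner_smul_right, norm_smul]
  have hre : (inner ℂ p.2 p.1 : ℂ).im = 0 := by
    rw [← Complex.conj_eq_iff_im, inner_conj_symm, h]
  simp [hre, mul_pow]

/-- `A + i l` is bounded below on the complete space `A.graph`, so its range is closed. A vector `z`
orthogonal to the range satisfies `A z = i l z`, which contradicts the reality of `⟪A z, z⟫` unless
`z = 0`. -/
theorem exists_resolvent (hA : IsSelfAdjoint A) {l : ℝ} (hl : l ≠ 0) (y : E) :
    ∃ x : E, (x, y - (Complex.I * l) • x) ∈ A.graph := by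
  let f : E × E →L[ℂ] E := ContinuousLinearMap.snd ℂ E E +
    (Complex.I * l) • ContinuousLinearMap.fst ℂ E E
  have hf : ∀ p : E × E, f p = p.2 + (Complex.I * l) • p.1 := fun p => rfl
  let g : A.graph →L[ℂ] E := f.comp A.graph.subtypeL
  have : CompleteSpace A.graph := (show IsClosed (A.graph : Set (E × E)) from
    hA.isClosed).completeSpace_coe
  have hanti : AntilipschitzWith (Real.toNNReal (1 + |l|⁻¹)) g := by
    refine AddMonoidHomClass.antilipschitz_of_bound g fun p => ?_
    have h1 := norm_sq_add_I_smul hA l p.2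
    have h2 : g p = (p : E × E).2 + (Complex.I * l) • (p : E × E).1 := rfl
    rw [← h2] at h1
    have hl' : 0 < |l| := abs_pos.2 hl
    rw [Real.coe_toNNReal _ (by positivity)]
    have h3 : ‖(p : E × E).2‖ ≤ ‖g p‖ := by
      refine le_of_sq_le_sq ?_ (norm_nonneg _)
      rw [h1]
      nlinarith [sq_nonneg (l * ‖(p : E × E).1‖)]
    have h4 : |l| * ‖(p : E × E).1‖ ≤ ‖g p‖ := by
      refine le_of_sq_le_sq ?_ (norm_nonneg _)
      rw [h1, mul_pow, sq_abs]
      nlinarith [sq_nonneg ‖(p : E × E).2‖]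
    have h5 : ‖(p : E × E).1‖ ≤ |l|⁻¹ * ‖g p‖ := by
      rw [inv_mul_eq_div, le_div_iff₀ hl', mul_comm]
      exact h4
    have h6 : (0 : ℝ) ≤ |l|⁻¹ * ‖g p‖ := by positivity
    change max ‖(p : E × E).1‖ ‖(p : E × E).2‖ ≤ _
    rw [add_mul, one_mul]
    exact max_le (by linarith [norm_nonneg (g p)]) (by linarith)
  have hclosed : IsClosed (Set.range g) := hanti.isClosed_range g.uniformContinuous
  have hrange : LinearMap.range (g : A.graph →ₗ[ℂ] E) = ⊤ := by
    have hc : (LinearMap.range (g : A.graph →ₗ[ℂ] E)).topologicalClosure =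
        LinearMap.range (g : A.graph →ₗ[ℂ] E) :=
      IsClosed.submodule_topologicalClosure_eq hclosed
    rw [← hc, Submodule.topologicalClosure_eq_top_iff, Submodule.eq_bot_iff]
    intro z hz
    have hz' : (z, (Complex.I * l) • z) ∈ A.graph := by
      rw [← graph_adjoint_of_isSelfAdjoint hA]
      refine mem_adjoint.2 fun q hq => ?_
      have h1 := (Submodule.mem_orthogonal _ z).1 hz (g ⟨q, hq⟩) ⟨⟨q, hq⟩, rfl⟩
      have h2 : inner ℂ (q.2 + (Complex.I * l) • q.1) z = 0 := h1
      rw [inner_add_left, inner_smul_left] at h2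
      rw [inner_smul_right]
      simp only [map_mul, Complex.conj_I, Complex.conj_ofReal] at h2
      linear_combination h2
    have h3 := inner_graph_comm hA hz' hz'
    simp only [inner_smul_left, inner_smul_right, map_mul, Complex.conj_I,
      Complex.conj_ofReal] at h3
    have h4 : (Complex.I * l) * inner ℂ z z = 0 := by linear_combination (-1 / 2 : ℂ) * h3
    have h5 : (Complex.I * (l : ℂ)) ≠ 0 := mul_ne_zero Complex.I_ne_zero (by exact_mod_cast hl)
    exact inner_self_eq_zero.1 ((mul_eq_zero.1 h4).resolve_left h5)
  obtain ⟨p, hp⟩ : y ∈ LinearMap.range (g : A.graph →ₗ[ℂ] E) := hrange ▸ Submodule.mem_top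
  have hp' : (p : E × E).2 + (Complex.I * l) • (p : E × E).1 = y := hp
  refine ⟨(p : E × E).1, ?_⟩
  rw [← hp', add_sub_cancel_right]
  exact p.2

theorem resolvent_unique (hA : IsSelfAdjoint A) {l : ℝ} (hl : l ≠ 0) {x x' y : E}
    (hx : (x, y - (Complex.I * l) • x) ∈ A.graph) (hx' : (x', y - (Complex.I * l) • x') ∈ A.graph) :
    x = x' := by
  have h := norm_sq_add_I_smul hA l (sub_mem hx hx')
  simp only [Prod.fst_sub, Prod.snd_sub] at h
  have h0 : y - (Complex.I * l) • x - (y - (Complex.I * l) • x') + (Complex.I * l) • (x - x') = 0 := by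
    rw [smul_sub]; abel
  rw [h0, norm_zero] at h
  have h2 : l ^ 2 * ‖x - x'‖ ^ 2 = 0 :=
    le_antisymm (by nlinarith [sq_nonneg ‖y - (Complex.I * l) • x - (y - (Complex.I * l) • x')‖])
      (by positivity)
  have h3 : ‖x - x'‖ = 0 := by simpa [hl] using h2
  exact sub_eq_zero.1 (norm_eq_zero.1 h3)

/-- The resolvent `(A + i l)⁻¹` of a self-adjoint operator. -/
def resolventCLM (hA : IsSelfAdjoint A) {l : ℝ} (hl : l ≠ 0) : E →L[ℂ] E :=
  LinearMap.mkContinuous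
    { toFun := fun y => (exists_resolvent hA hl y).choose
      map_add' := fun y z => by
        refine resolvent_unique hA hl (exists_resolvent hA hl (y + z)).choose_spec ?_
        have h := add_mem (exists_resolvent hA hl y).choose_spec
          (exists_resolvent hA hl z).choose_spec
        convert h using 1
        simp only [Prod.mk_add_mk, smul_add, Prod.mk.injEq, true_and]
        abel
      map_smul' := fun c y => by
        refine resolvent_unique hA hl (exists_resolvent hA hl (c • y)).choose_spec ?_
        have h := A.graph.smul_mem c (exists_resolvent hA hl y).choose_spec
        convert h using 1
        simp only [Prod.smul_mk, smul_sub, RingHom.id_apply, smul_comm c] } |l|⁻¹ (fun y => by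
    have h := norm_sq_add_I_smul hA l (exists_resolvent hA hl y).choose_spec
    simp only [sub_add_cancel] at h
    have hl' : 0 < |l| := abs_pos.2 hl
    rw [inv_mul_eq_div, le_div_iff₀ hl', mul_comm]
    refine le_of_sq_le_sq ?_ (norm_nonneg _)
    rw [h, mul_pow, sq_abs]
    exact le_add_of_nonneg_left (sq_nonneg _))

theorem resolventCLM_mem (hA : IsSelfAdjoint A) {l : ℝ} (hl : l ≠ 0) (y : E) :
    (resolventCLM hA hl y, y - (Complex.I * l) • resolventCLM hA hl y) ∈ A.graph :=
  (exists_resolvent hA hl y).choose_spec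

theorem norm_resolventCLM_le (hA : IsSelfAdjoint A) {l : ℝ} (hl : l ≠ 0) :
    ‖resolventCLM hA hl‖ ≤ |l|⁻¹ :=
  LinearMap.mkContinuous_norm_le _ (by positivity) _

theorem resolventCLM_eq (hA : IsSelfAdjoint A) {l : ℝ} (hl : l ≠ 0) {p : E × E}
    (hp : p ∈ A.graph) : resolventCLM hA hl (p.2 + (Complex.I * l) • p.1) = p.1 := by
  refine resolvent_unique hA hl (resolventCLM_mem hA hl _) ?_
  rw [add_sub_cancel_right]
  exact hp

/-- Applying `T` to the resolvent equation for `y` gives the resolvent equation for `T y`, whose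
solution is unique. The case where `T` is another resolvent makes the Yosida approximants commute.
-/
theorem resolventCLM_comm (hA : IsSelfAdjoint A) {l : ℝ} (hl : l ≠ 0) {T : E →L[ℂ] E}
    (hT : ∀ p ∈ A.graph, (T p.1, T p.2) ∈ A.graph) : Commute (resolventCLM hA hl) T := by
  ext y
  refine resolvent_unique hA hl (resolventCLM_mem hA hl (T y)) ?_
  have := hT _ (resolventCLM_mem hA hl y)
  simpa using this

theorem resolventCLM_mem_graph (hA : IsSelfAdjoint A) {l : ℝ} (hl : l ≠ 0) {p : E × E}
    (hp : p ∈ A.graph) : (resolventCLM hA hl p.1, resolventCLM hA hl p.2) ∈ A.graph := by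
  have h := resolventCLM_mem hA hl p.1
  have h2 := resolventCLM_eq hA hl hp
  rw [map_add, map_smul] at h2
  rwa [← eq_sub_iff_add_eq.2 h2] at h

theorem resolventCLM_commute (hA : IsSelfAdjoint A) {l m : ℝ} (hl : l ≠ 0) (hm : m ≠ 0) :
    Commute (resolventCLM hA hl) (resolventCLM hA hm) :=
  resolventCLM_comm hA hl fun _ hp => resolventCLM_mem_graph hA hm hp

theorem adjoint_resolventCLM (hA : IsSelfAdjoint A) {l : ℝ} (hl : l ≠ 0) :
    ContinuousLinearMap.adjoint (resolventCLM hA hl) = resolventCLM hA (neg_ne_zero.2 hl) := by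
  symm
  rw [ContinuousLinearMap.eq_adjoint_iff]
  intro x y
  have h := inner_graph_comm hA (resolventCLM_mem hA hl y)
    (resolventCLM_mem hA (neg_ne_zero.2 hl) x)
  simp only [inner_sub_left, inner_sub_right, inner_smul_left, inner_smul_right, map_mul,
    Complex.conj_I, Complex.conj_ofReal, Complex.ofReal_neg, map_neg] at h
  linear_combination -h

/-- The bounded approximation `l² A (A² + l²)⁻¹` of a self-adjoint operator `A`. -/
def yosida (hA : IsSelfAdjoint A) {l : ℝ} (hl : l ≠ 0) : E →L[ℂ] E :=
  ((l ^ 2 / 2 : ℝ) : ℂ) • (resolventCLM hA hl + resolventCLM hA (neg_ne_zero.2 hl))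

theorem isSelfAdjoint_yosida (hA : IsSelfAdjoint A) {l : ℝ} (hl : l ≠ 0) :
    IsSelfAdjoint (yosida hA hl) := by
  rw [ContinuousLinearMap.isSelfAdjoint_iff', yosida, map_smulₛₗ, map_add, adjoint_resolventCLM,
    adjoint_resolventCLM, Complex.conj_ofReal, add_comm]
  simp only [neg_neg]

theorem yosida_commute (hA : IsSelfAdjoint A) {l m : ℝ} (hl : l ≠ 0) (hm : m ≠ 0) :
    Commute (yosida hA hl) (yosida hA hm) := by
  refine Commute.smul_left (Commute.smul_right ?_ _) _
  exact ((resolventCLM_commute hA _ _).add_left (resolventCLM_commute hA _ _)).add_right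
    ((resolventCLM_commute hA _ _).add_left (resolventCLM_commute hA _ _))

/-- For `x` in the domain, `i l R x = x - R (A x)` with `R = (A + i l)⁻¹`, and the error is at most
`‖A x‖ / |l|`. The operators `i l R` are contractions, so convergence extends from the dense domain
to all of `E`. -/
theorem tendsto_resolventCLM (hA : IsSelfAdjoint A) (l : ℕ → ℝ) (hl : ∀ n, l n ≠ 0)
    (hlim : Filter.Tendsto (fun n => |l n|⁻¹) Filter.atTop (nhds 0)) (y : E) :
    Filter.Tendsto (fun n => (Complex.I * l n) • resolventCLM hA (hl n) y) Filter.atTop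
      (nhds y) := by
  have hcore : ∀ p ∈ A.graph, Filter.Tendsto
      (fun n => (Complex.I * l n) • resolventCLM hA (hl n) p.1) Filter.atTop (nhds p.1) := by
    intro p hp
    rw [tendsto_iff_norm_sub_tendsto_zero]
    refine squeeze_zero (fun _ => norm_nonneg _) (fun n => ?_)
      (by simpa using hlim.mul_const ‖p.2‖)
    have h2 := resolventCLM_eq hA (hl n) hp
    rw [map_add, map_smul] at h2
    rw [← norm_neg, neg_sub, ← eq_sub_iff_add_eq.2 h2]
    exact (resolventCLM hA (hl n)).le_of_opNorm_le (norm_resolventCLM_le hA (hl n)) _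
  have hb : ∀ n, ∀ x, ‖(Complex.I * l n) • resolventCLM hA (hl n) x‖ ≤ ‖x‖ := by
    intro n x
    have h1 := (resolventCLM hA (hl n)).le_of_opNorm_le (norm_resolventCLM_le hA (hl n)) x
    have h2 : 0 < |l n| := abs_pos.2 (hl n)
    rw [norm_smul, norm_mul, Complex.norm_I, one_mul, Complex.norm_real, Real.norm_eq_abs]
    calc |l n| * ‖resolventCLM hA (hl n) x‖ ≤ |l n| * (|l n|⁻¹ * ‖x‖) := by gcongr
      _ = ‖x‖ := by field_simp
  rw [Metric.tendsto_atTop]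
  intro ε hε
  obtain ⟨z, hz, hyz⟩ := Metric.dense_iff.1 hA.dense_domain y (ε / 3) (by positivity)
  have hz' := hcore _ (A.mem_graph ⟨z, hyz⟩)
  obtain ⟨N, hN⟩ := Metric.tendsto_atTop.1 hz' (ε / 3) (by positivity)
  refine ⟨N, fun n hn => ?_⟩
  have h1 := hN n hn
  have h2 := hb n (y - z)
  rw [map_sub, smul_sub] at h2
  rw [Metric.mem_ball, dist_comm, dist_eq_norm] at hz
  rw [dist_eq_norm] at h1 ⊢
  simp only at h1
  set a := (Complex.I * l n) • resolventCLM hA (hl n) y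
  set b := (Complex.I * l n) • resolventCLM hA (hl n) z
  have h3 : a - y = (a - b) + (b - z) - (y - z) := by abel
  rw [h3]
  have h4 := norm_sub_le ((a - b) + (b - z)) (y - z)
  have h5 := norm_add_le (a - b) (b - z)
  linarith

/-- On the domain the approximant equals the average of `i l R_l (A x)` and `-i l R_{-l} (A x)`,
where the multiples of `x` cancel; each of the two tends to `A x`. -/
theorem tendsto_yosida (hA : IsSelfAdjoint A) (l : ℕ → ℝ) (hl : ∀ n, l n ≠ 0)
    (hlim : Filter.Tendsto (fun n => |l n|⁻¹) Filter.atTop (nhds 0)) {p : E × E}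
    (hp : p ∈ A.graph) :
    Filter.Tendsto (fun n => yosida hA (hl n) p.1) Filter.atTop (nhds p.2) := by
  have h1 := tendsto_resolventCLM hA l hl hlim p.2
  have h2 := tendsto_resolventCLM hA (fun n => -l n) (fun n => neg_ne_zero.2 (hl n))
    (by simpa using hlim) p.2
  have h3 := (h1.add h2).const_smul (1 / 2 : ℂ)
  have h4 : (1 / 2 : ℂ) • (p.2 + p.2) = p.2 := by
    rw [← two_smul ℂ p.2, smul_smul]; norm_num
  rw [h4] at h3
  refine h3.congr fun n => ?_
  have e1 := resolventCLM_eq hA (hl n) hp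
  have e2 := resolventCLM_eq hA (neg_ne_zero.2 (hl n)) hp
  rw [map_add, map_smul] at e1 e2
  rw [eq_sub_of_add_eq e1, eq_sub_of_add_eq e2]
  have hI : Complex.I * Complex.I = -1 := Complex.I_mul_I
  rw [yosida]
  simp only [smul_apply, add_apply, smul_sub, smul_add,
    smul_smul, Complex.ofReal_neg]
  have e3 : (1 / 2 : ℂ) * (Complex.I * l n * (Complex.I * l n)) = -(((l n) ^ 2 / 2 : ℝ) : ℂ) := by
    push_cast; linear_combination (1 / 2 * (l n : ℂ) ^ 2) * hI
  have e4 : (1 / 2 : ℂ) * (Complex.I * -(l n) * (Complex.I * -(l n))) =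
      -(((l n) ^ 2 / 2 : ℝ) : ℂ) := by
    push_cast; linear_combination (1 / 2 * (l n : ℂ) ^ 2) * hI
  rw [e3, e4]
  have e5 : (1 / 2 : ℂ) * (Complex.I * -(l n)) = -((1 / 2 : ℂ) * (Complex.I * l n)) := by ring
  rw [e5]
  simp only [neg_smul]
  abel

end Stone

/-! ### One-parameter unitary groups and their generators -/

section UnitaryGroups

variable {E : Type*} [NormedAddCommGroup E] [InnerProductSpace ℂ E]
  {A : E →ₗ.[ℂ] E} {W : ℝ → E ≃ₗᵢ[ℂ] E}

/-- A self-adjoint operator has no proper symmetric extension, so it is enough that the generator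
extends `A`. Concretely, differentiating the constant `⟪W t q, W t x⟫` at `0` puts `(x, y)` in the
adjoint of the graph. -/
theorem isUnitaryGroupOf_of_hasDerivAt (hA : A.graph.adjoint = A.graph)
    (h0 : W 0 = LinearIsometryEquiv.refl ℂ E) (hadd : ∀ s t : ℝ, W (s + t) = (W t).trans (W s))
    (hcont : ∀ x : E, Continuous fun t : ℝ => W t x)
    (hder : ∀ p ∈ A.graph, HasDerivAt (fun t : ℝ => W t p.1) (Complex.I • p.2) 0) :
    IsUnitaryGroupOf A W := by
  refine ⟨h0, hadd, hcont, fun x y => ⟨fun h => hder _ h, fun h => ?_⟩⟩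
  rw [← hA]
  refine mem_adjoint.2 fun q hq => ?_
  have h1 := (hder q hq).inner ℂ h
  have h2 : (fun t : ℝ => inner ℂ (W t q.1) (W t x)) = fun _ => inner ℂ q.1 x := by
    funext t
    exact (W t).inner_map_map _ _
  rw [h2] at h1
  have h3 := h1.unique (hasDerivAt_const (0 : ℝ) (inner ℂ q.1 x))
  simp only [h0, LinearIsometryEquiv.coe_refl, id_eq, inner_smul_left, inner_smul_right,
    Complex.conj_I] at h3
  have h4 : Complex.I * (inner ℂ q.2 x - inner ℂ q.1 y) = 0 := by linear_combination -h3
  exact sub_eq_zero.1 ((mul_eq_zero.1 h4).resolve_left Complex.I_ne_zero)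

theorem continuous_uncurry_of_continuous (hW : ∀ x : E, Continuous fun t : ℝ => W t x) :
    Continuous fun p : ℝ × E => W p.1 p.2 := by
  rw [continuous_iff_continuousAt]
  rintro ⟨t, x⟩
  rw [ContinuousAt, tendsto_iff_norm_sub_tendsto_zero]
  have h1 : Filter.Tendsto (fun p : ℝ × E => ‖p.2 - x‖ + ‖W p.1 x - W t x‖) (nhds (t, x))
      (nhds 0) := by
    have : Continuous fun p : ℝ × E => ‖p.2 - x‖ + ‖W p.1 x - W t x‖ :=
      (continuous_snd.sub continuous_const).norm.add
        (((hW x).comp continuous_fst).sub continuous_const).norm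
    simpa using this.tendsto (t, x)
  refine squeeze_zero (fun _ => norm_nonneg _) (fun p => ?_) h1
  have h2 : W p.1 p.2 - W t x = W p.1 (p.2 - x) + (W p.1 x - W t x) := by rw [map_sub]; abel
  rw [h2]
  exact (norm_add_le _ _).trans (by rw [LinearIsometryEquiv.norm_map])

namespace IsUnitaryGroupOf

theorem add_apply (hW : IsUnitaryGroupOf A W) (s t : ℝ) (x : E) : W (s + t) x = W s (W t x) := by
  rw [hW.map_add]; rfl

theorem zero_apply (hW : IsUnitaryGroupOf A W) (x : E) : W 0 x = x := by
  rw [hW.map_zero]; rfl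

theorem symm_apply (hW : IsUnitaryGroupOf A W) (t : ℝ) (x : E) : (W t).symm x = W (-t) x := by
  apply (W t).injective
  rw [LinearIsometryEquiv.apply_symm_apply, ← hW.add_apply, add_neg_cancel, hW.zero_apply]

theorem continuous_uncurry (hW : IsUnitaryGroupOf A W) :
    Continuous fun p : ℝ × E => W p.1 p.2 :=
  continuous_uncurry_of_continuous hW.continuous

theorem hasDerivAt (hW : IsUnitaryGroupOf A W) {p : E × E} (hp : p ∈ A.graph) (t : ℝ) :
    HasDerivAt (fun s : ℝ => W s p.1) (W t (Complex.I • p.2)) t := by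
  have h1 : HasDerivAt (fun s : ℝ => W (s - t) p.1) (Complex.I • p.2) t := by
    have h := (hW.generator p.1 p.2).1 hp
    rw [← sub_self t] at h
    exact h.comp_sub_const t t
  have h2 := ((W t).toContinuousLinearEquiv.toContinuousLinearMap.restrictScalars ℝ
    ).hasFDerivAt.comp_hasDerivAt t h1
  refine h2.congr_of_eventuallyEq (Filter.Eventually.of_forall fun s => ?_)
  change W s p.1 = W t (W (s - t) p.1)
  rw [← hW.add_apply, add_sub_cancel]

theorem map_mem_graph (hW : IsUnitaryGroupOf A W) {p : E × E} (hp : p ∈ A.graph) (t : ℝ) :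
    (W t p.1, W t p.2) ∈ A.graph := by
  rw [hW.generator]
  have h2 := ((W t).toContinuousLinearEquiv.toContinuousLinearMap.restrictScalars ℝ
    ).hasFDerivAt.comp_hasDerivAt 0 ((hW.generator p.1 p.2).1 hp)
  have h3 : HasDerivAt (fun s => W t (W s p.1)) (W t (Complex.I • p.2)) 0 := h2
  rw [map_smul] at h3
  refine h3.congr_of_eventuallyEq (Filter.Eventually.of_forall fun s => ?_)
  change W s (W t p.1) = W t (W s p.1)
  rw [← hW.add_apply, ← hW.add_apply, add_comm]

/-- This bounds difference quotients uniformly in `t`, as dominated convergence requires when the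
fibrewise group is differentiated. -/
theorem norm_sub_le (hW : IsUnitaryGroupOf A W) {p : E × E} (hp : p ∈ A.graph) (t : ℝ) :
    ‖W t p.1 - p.1‖ ≤ |t| * ‖p.2‖ := by
  have h := Convex.norm_image_sub_le_of_norm_hasDerivWithin_le (s := Set.univ)
    (f := fun s : ℝ => W s p.1) (f' := fun s => W s (Complex.I • p.2)) (C := ‖p.2‖) (x := 0)
    (y := t) (fun s _ => (hW.hasDerivAt hp s).hasDerivWithinAt)
    (fun s _ => by rw [LinearIsometryEquiv.norm_map, norm_smul, Complex.norm_I, one_mul])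
    convex_univ (Set.mem_univ _) (Set.mem_univ _)
  simpa [hW.zero_apply, mul_comm] using h

end IsUnitaryGroupOf

theorem hasDerivAt_zero_of_eq_integral [CompleteSpace E] {f g : ℝ → E} (hg : Continuous g)
    (h : ∀ t, f t - f 0 = ∫ s in (0 : ℝ)..t, g s) : HasDerivAt f (g 0) 0 := by
  have h1 : HasDerivAt (fun t => (∫ s in (0 : ℝ)..t, g s) + f 0) (g 0) 0 :=
    ((hg.integral_hasStrictDerivAt 0 0).hasDerivAt).add_const _
  refine h1.congr_of_eventuallyEq (Filter.Eventually.of_forall fun t => ?_)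
  simp only [← h, sub_add_cancel]

/-- Differentiability does not pass to limits directly, but its integrated form `W t x - x = ∫ W r
(i y) dr` is a closed linear condition on `(x, y)`, and it gives the derivative back. -/
theorem hasDerivAt_zero_of_mem_topologicalClosure_span [CompleteSpace E]
    (h0 : W 0 = LinearIsometryEquiv.refl ℂ E) (hadd : ∀ s t : ℝ, W (s + t) = (W t).trans (W s))
    (hcont : ∀ x : E, Continuous fun t : ℝ => W t x) {s : Set (E × E)}
    (hder : ∀ p ∈ s, HasDerivAt (fun t : ℝ => W t p.1) (Complex.I • p.2) 0)
    {p : E × E} (hp : p ∈ (Submodule.span ℂ s).topologicalClosure) :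
    HasDerivAt (fun t : ℝ => W t p.1) (Complex.I • p.2) 0 := by
  have hint : ∀ y : E, ∀ t : ℝ, IntervalIntegrable (fun r => W r y) volume 0 t := fun y t =>
    (hcont y).intervalIntegrable _ _
  let K : Submodule ℂ (E × E) :=
    { carrier := {p | ∀ t : ℝ, W t p.1 - W 0 p.1 = ∫ r in (0 : ℝ)..t, W r (Complex.I • p.2)}
      zero_mem' := fun t => by simp
      add_mem' := fun {a b} ha hb t => by
        simp only [Prod.fst_add, Prod.snd_add, smul_add, map_add]
        rw [intervalIntegral.integral_add (hint _ _) (hint _ _), ← ha t, ← hb t]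
        abel
      smul_mem' := fun c a ha t => by
        have e : ∀ r : ℝ, W r (Complex.I • c • a.2) = c • W r (Complex.I • a.2) := fun r => by
          rw [smul_comm, map_smul]
        simp only [Prod.smul_fst, Prod.smul_snd, e]
        rw [intervalIntegral.integral_smul, ← ha t, smul_sub, map_smul, map_smul] }
  have hK : IsClosed (K : Set (E × E)) := by
    have : (K : Set (E × E)) = ⋂ t : ℝ,
        {p | W t p.1 - W 0 p.1 = ∫ r in (0 : ℝ)..t, W r (Complex.I • p.2)} := by
      ext p
      simp only [Set.mem_iInter]
      rfl
    rw [this]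
    refine isClosed_iInter fun t => isClosed_eq ?_ ?_
    · exact ((W t).continuous.comp continuous_fst).sub ((W 0).continuous.comp continuous_fst)
    · refine intervalIntegral.continuous_parametric_intervalIntegral_of_continuous' ?_ _ _
      exact (continuous_uncurry_of_continuous hcont).comp
        (continuous_snd.prodMk ((continuous_snd.comp continuous_fst).const_smul Complex.I))
  have hsK : s ⊆ K := by
    intro p hp t
    have hd : ∀ r : ℝ, HasDerivAt (fun t : ℝ => W t p.1) (W r (Complex.I • p.2)) r := by
      intro r
      have h1 : HasDerivAt (fun s : ℝ => W (s - r) p.1) (Complex.I • p.2) r := by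
        have h := hder p hp
        rw [← sub_self r] at h
        exact h.comp_sub_const r r
      have h2 := ((W r).toContinuousLinearEquiv.toContinuousLinearMap.restrictScalars ℝ
        ).hasFDerivAt.comp_hasDerivAt r h1
      refine h2.congr_of_eventuallyEq (Filter.Eventually.of_forall fun s => ?_)
      change W s p.1 = W r (W (s - r) p.1)
      rw [← LinearIsometryEquiv.trans_apply, ← hadd, add_sub_cancel]
    exact (intervalIntegral.integral_eq_sub_of_hasDerivAt (fun r _ => hd r) (hint _ _)).symm
  have hpK : p ∈ K := Submodule.topologicalClosure_minimal _ (Submodule.span_le.2 hsK) hK hp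
  have h := hasDerivAt_zero_of_eq_integral (hcont (Complex.I • p.2)) hpK
  rwa [h0] at h

end UnitaryGroups

/-! ### The unitary group of a bounded self-adjoint operator -/

section Exponential

variable {E : Type*} [NormedAddCommGroup E] [InnerProductSpace ℂ E] [CompleteSpace E]

/-- `exp (i t B)` for a bounded operator `B`. -/
def expCLM (B : E →L[ℂ] E) (t : ℝ) : E →L[ℂ] E := NormedSpace.exp (t • (Complex.I • B))

theorem expCLM_zero (B : E →L[ℂ] E) : expCLM B 0 = 1 := by
  rw [expCLM, zero_smul, NormedSpace.exp_zero]

theorem expCLM_add (B : E →L[ℂ] E) (s t : ℝ) : expCLM B (s + t) = expCLM B s * expCLM B t := by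
  let : NormedAlgebra ℚ (E →L[ℂ] E) := .restrictScalars ℚ ℂ _
  rw [expCLM, add_smul, NormedSpace.exp_add_of_commute]
  · rfl
  · exact ((Commute.refl _).smul_left _).smul_right _

theorem norm_expCLM_apply {B : E →L[ℂ] E} (hB : IsSelfAdjoint B) (t : ℝ) (x : E) :
    ‖expCLM B t x‖ = ‖x‖ := by
  have h : expCLM B t = (selfAdjoint.expUnitary (t • (⟨B, hB⟩ : selfAdjoint (E →L[ℂ] E))) :
      E →L[ℂ] E) := by
    rw [selfAdjoint.expUnitary_coe, expCLM, smul_comm]; rfl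
  rw [h]
  exact ContinuousLinearMap.norm_map_of_mem_unitary (SetLike.coe_mem _) x

theorem hasDerivAt_expCLM (B : E →L[ℂ] E) (x : E) (t : ℝ) :
    HasDerivAt (fun s => expCLM B s x) (expCLM B t (Complex.I • B x)) t := by
  have h := hasDerivAt_exp_smul_const (𝕂 := ℝ) (Complex.I • B) t
  exact ((ContinuousLinearMap.apply ℂ E x).restrictScalars ℝ).hasFDerivAt.comp_hasDerivAt t h

theorem norm_expCLM_sub_le {B : E →L[ℂ] E} (hB : IsSelfAdjoint B) (t : ℝ) (x : E) :
    ‖expCLM B t x - x‖ ≤ |t| * ‖B x‖ := by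
  have h := Convex.norm_image_sub_le_of_norm_hasDerivWithin_le (s := Set.univ)
    (f := fun s : ℝ => expCLM B s x) (f' := fun s => expCLM B s (Complex.I • B x)) (C := ‖B x‖)
    (x := 0) (y := t) (fun s _ => (hasDerivAt_expCLM B x s).hasDerivWithinAt)
    (fun s _ => by rw [norm_expCLM_apply hB, norm_smul, Complex.norm_I, one_mul])
    convex_univ (Set.mem_univ _) (Set.mem_univ _)
  simpa [expCLM_zero, mul_comm] using h

/-- By commutation `exp (i t B) = exp (i t C) exp (i t (B - C))`; the unitary factor `exp (i t C)`
does not affect norms. -/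
theorem norm_expCLM_sub_expCLM_le {B C : E →L[ℂ] E} (hB : IsSelfAdjoint B) (hC : IsSelfAdjoint C)
    (h : Commute B C) (t : ℝ) (x : E) :
    ‖expCLM B t x - expCLM C t x‖ ≤ |t| * ‖B x - C x‖ := by
  let : NormedAlgebra ℚ (E →L[ℂ] E) := .restrictScalars ℚ ℂ _
  have h1 : expCLM B t = expCLM C t * expCLM (B - C) t := by
    rw [expCLM, expCLM, expCLM, ← NormedSpace.exp_add_of_commute]
    · rw [← smul_add, ← smul_add, add_sub_cancel]
    · exact ((((h.symm.sub_right (Commute.refl C)).smul_left _).smul_right _).smul_left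
        _).smul_right _
  have h2 : expCLM B t x - expCLM C t x = expCLM C t (expCLM (B - C) t x - x) := by
    rw [h1, map_sub]; rfl
  rw [h2, norm_expCLM_apply hC]
  exact norm_expCLM_sub_le (hB.sub hC) t x

end Exponential

/-! ### Existence of the unitary group of a self-adjoint operator -/

section StoneGroup

variable {E : Type*} [NormedAddCommGroup E] [InnerProductSpace ℂ E] [CompleteSpace E]
  {A : E →ₗ.[ℂ] E}

/-- On the domain of `A` the exponentials are Cauchy because the `B n x` are; the isometry property
carries this over to all vectors by density. -/
theorem exists_tendsto_expCLM {B : ℕ → E →L[ℂ] E} (hB : ∀ n, IsSelfAdjoint (B n))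
    (hcomm : ∀ n m, Commute (B n) (B m)) (hA : Dense (A.domain : Set E))
    (hlim : ∀ p ∈ A.graph, Filter.Tendsto (fun n => B n p.1) Filter.atTop (nhds p.2))
    (t : ℝ) (x : E) :
    ∃ y, Filter.Tendsto (fun n => expCLM (B n) t x) Filter.atTop (nhds y) := by
  refine cauchySeq_tendsto_of_complete ?_
  rw [Metric.cauchySeq_iff]
  intro ε hε
  obtain ⟨z, hz, hzA⟩ := Metric.dense_iff.1 hA x (ε / 4) (by positivity)
  have hc := (hlim _ (A.mem_graph ⟨z, hzA⟩)).cauchySeq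
  obtain ⟨N, hN⟩ := Metric.cauchySeq_iff.1 hc (ε / (4 * (|t| + 1))) (by positivity)
  refine ⟨N, fun m hm n hn => ?_⟩
  have h1 := hN m hm n hn
  have h2 := norm_expCLM_sub_expCLM_le (hB m) (hB n) (hcomm m n) t z
  have h3 := norm_expCLM_apply (hB m) t (x - z)
  have h4 := norm_expCLM_apply (hB n) t (x - z)
  rw [map_sub] at h3 h4
  rw [Metric.mem_ball, dist_comm, dist_eq_norm] at hz
  rw [dist_eq_norm] at h1 ⊢
  simp only at h1
  have h5 : |t| * ‖B m z - B n z‖ ≤ ε / 4 := by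
    rw [lt_div_iff₀ (by positivity)] at h1
    nlinarith [norm_nonneg (B m z - B n z), abs_nonneg t]
  have h6 : expCLM (B m) t x - expCLM (B n) t x = (expCLM (B m) t x - expCLM (B m) t z) +
      (expCLM (B m) t z - expCLM (B n) t z) - (expCLM (B n) t x - expCLM (B n) t z) := by abel
  rw [h6]
  have h7 := norm_sub_le ((expCLM (B m) t x - expCLM (B m) t z) +
      (expCLM (B m) t z - expCLM (B n) t z)) (expCLM (B n) t x - expCLM (B n) t z)
  have h8 := norm_add_le (expCLM (B m) t x - expCLM (B m) t z)
      (expCLM (B m) t z - expCLM (B n) t z)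
  linarith

/-- The group is the strong limit of `exp (i t B n)` for the Yosida approximants `B n`, here with `l
= n + 1`. Norms, linearity and the group law pass to the limit; the derivative passes in its
integrated form, by dominated convergence. -/
theorem exists_isUnitaryGroupOf (hA : IsSelfAdjoint A) :
    ∃ W : ℝ → E ≃ₗᵢ[ℂ] E, IsUnitaryGroupOf A W := by
  have hl : ∀ n : ℕ, ((n : ℝ) + 1) ≠ 0 := fun n => by positivity
  have hl0 : Filter.Tendsto (fun n : ℕ => |(n : ℝ) + 1|⁻¹) Filter.atTop (nhds 0) := by
    refine (tendsto_one_div_add_atTop_nhds_zero_nat (𝕜 := ℝ)).congr fun n => ?_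
    rw [abs_of_pos (by positivity), one_div]
  set B : ℕ → E →L[ℂ] E := fun n => yosida hA (hl n) with hBdef
  have hB : ∀ n, IsSelfAdjoint (B n) := fun n => isSelfAdjoint_yosida hA _
  have hlim : ∀ p ∈ A.graph, Filter.Tendsto (fun n => B n p.1) Filter.atTop (nhds p.2) :=
    fun p hp => tendsto_yosida hA _ hl hl0 hp
  choose V hV using exists_tendsto_expCLM hB (fun n m => yosida_commute hA _ _) hA.dense_domain hlim
  have hnorm : ∀ t x, ‖V t x‖ = ‖x‖ := fun t x =>
    tendsto_nhds_unique (hV t x).norm (by simp only [norm_expCLM_apply (hB _), tendsto_const_nhds])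
  have hadd : ∀ t x y, V t (x + y) = V t x + V t y := fun t x y =>
    tendsto_nhds_unique (hV t (x + y)) (by simpa only [map_add] using (hV t x).add (hV t y))
  have hsmul : ∀ t (c : ℂ) x, V t (c • x) = c • V t x := fun t c x =>
    tendsto_nhds_unique (hV t (c • x)) (by simpa only [map_smul] using (hV t x).const_smul c)
  have hzero : ∀ x, V 0 x = x := fun x =>
    tendsto_nhds_unique (hV 0 x) (by simp [expCLM_zero])
  have hmul : ∀ s t x, V (s + t) x = V s (V t x) := fun s t x => by
    refine tendsto_nhds_unique (hV (s + t) x) ?_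
    have h1 : Filter.Tendsto (fun n => expCLM (B n) s (expCLM (B n) t x - V t x)) Filter.atTop
        (nhds 0) := by
      rw [tendsto_zero_iff_norm_tendsto_zero]
      simp only [norm_expCLM_apply (hB _)]
      exact tendsto_iff_norm_sub_tendsto_zero.1 (hV t x)
    have h2 := h1.add (hV s (V t x))
    rw [zero_add] at h2
    refine h2.congr fun n => ?_
    rw [map_sub, sub_add_cancel, expCLM_add]; rfl
  have hsub : ∀ t x y, V t (x - y) = V t x - V t y := fun t x y => by
    rw [sub_eq_add_neg, hadd, ← neg_one_smul ℂ y, hsmul, neg_one_smul, ← sub_eq_add_neg]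
  -- The Lipschitz bound survives in the limit although `‖B n‖` need not be bounded, because it only
  -- involves `‖B n x‖ → ‖A x‖`. It yields strong continuity, first on the domain and then by
  -- density.
  have hlip : ∀ p ∈ A.graph, ∀ t, ‖V t p.1 - p.1‖ ≤ |t| * ‖p.2‖ := fun p hp t =>
    le_of_tendsto_of_tendsto ((hV t p.1).sub_const p.1).norm ((hlim p hp).norm.const_mul |t|)
      (Filter.Eventually.of_forall fun n => norm_expCLM_sub_le (hB n) t p.1)
  have hcont : ∀ x, Continuous fun t => V t x := by
    intro x
    rw [Metric.continuous_iff]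
    intro t ε hε
    obtain ⟨z, hz, hzA⟩ := Metric.dense_iff.1 hA.dense_domain x (ε / 3) (by positivity)
    refine ⟨ε / (3 * (‖A ⟨z, hzA⟩‖ + 1)), by positivity, fun s hs => ?_⟩
    have h1 := hlip _ (A.mem_graph ⟨z, hzA⟩) (s - t)
    have h2 : ‖V s x - V t x‖ = ‖V (s - t) x - x‖ := by
      rw [← hnorm t (V (s - t) x - x), hsub, ← hmul, add_sub_cancel]
    rw [dist_eq_norm, h2]
    rw [Real.dist_eq, lt_div_iff₀ (by positivity)] at hs
    rw [Metric.mem_ball, dist_comm, dist_eq_norm] at hz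
    have h3 : V (s - t) x - x = V (s - t) (x - z) + (V (s - t) z - z) - (x - z) := by
      rw [hsub]; abel
    have h4 := norm_sub_le (V (s - t) (x - z) + (V (s - t) z - z)) (x - z)
    have h5 := norm_add_le (V (s - t) (x - z)) (V (s - t) z - z)
    rw [hnorm] at h5
    rw [h3]
    simp only at h1
    nlinarith [abs_nonneg (s - t)]
  let W : ℝ → E ≃ₗᵢ[ℂ] E := fun t =>
    { toFun := V t
      invFun := V (-t)
      left_inv := fun x => by rw [← hmul, neg_add_cancel, hzero]
      right_inv := fun x => by rw [← hmul, add_neg_cancel, hzero]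
      map_add' := hadd t
      map_smul' := hsmul t
      norm_map' := hnorm t }
  refine ⟨W, isUnitaryGroupOf_of_hasDerivAt (graph_adjoint_of_isSelfAdjoint hA)
    (LinearIsometryEquiv.ext hzero) (fun s t => LinearIsometryEquiv.ext (hmul s t)) hcont ?_⟩
  intro p hp
  have hint : ∀ t, V t p.1 - V 0 p.1 = ∫ s in (0 : ℝ)..t, V s (Complex.I • p.2) := by
    intro t
    have h1 : ∀ n, expCLM (B n) t p.1 - p.1 =
        ∫ s in (0 : ℝ)..t, expCLM (B n) s (Complex.I • B n p.1) := by
      intro n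
      have hc : Continuous fun s => expCLM (B n) s (Complex.I • B n p.1) :=
        continuous_iff_continuousAt.2 fun s => (hasDerivAt_expCLM (B n) _ s).continuousAt
      rw [intervalIntegral.integral_eq_sub_of_hasDerivAt
        (fun s _ => hasDerivAt_expCLM (B n) p.1 s) (hc.intervalIntegrable _ _), expCLM_zero]
      rfl
    obtain ⟨M, hM⟩ := (hlim p hp).norm.bddAbove_range
    have h2 : Filter.Tendsto (fun n => ∫ s in (0 : ℝ)..t, expCLM (B n) s (Complex.I • B n p.1))
        Filter.atTop (nhds (∫ s in (0 : ℝ)..t, V s (Complex.I • p.2))) := by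
      refine intervalIntegral.tendsto_integral_filter_of_dominated_convergence (fun _ => M)
        (Filter.Eventually.of_forall fun n => ?_) (Filter.Eventually.of_forall fun n => ?_)
        (by simp) ?_
      · exact (continuous_iff_continuousAt.2 fun s =>
          (hasDerivAt_expCLM (B n) _ s).continuousAt).aestronglyMeasurable
      · refine Filter.Eventually.of_forall fun s _ => ?_
        rw [norm_expCLM_apply (hB n), norm_smul, Complex.norm_I, one_mul]
        exact hM ⟨n, rfl⟩
      · refine Filter.Eventually.of_forall fun s _ => ?_
        have h3 : Filter.Tendsto (fun n => expCLM (B n) s (Complex.I • (B n p.1 - p.2)))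
            Filter.atTop (nhds 0) := by
          rw [tendsto_zero_iff_norm_tendsto_zero]
          simp only [norm_expCLM_apply (hB _), norm_smul, Complex.norm_I, one_mul]
          exact tendsto_iff_norm_sub_tendsto_zero.1 (hlim p hp)
        have h4 := h3.add (hV s (Complex.I • p.2))
        rw [zero_add] at h4
        refine h4.congr fun n => ?_
        rw [← map_add, ← smul_add, sub_add_cancel]
    rw [hzero]
    refine tendsto_nhds_unique ((hV t p.1).sub_const p.1) (h2.congr fun n => (h1 n).symm)
  have h := hasDerivAt_zero_of_eq_integral (hcont (Complex.I • p.2)) hint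
  rwa [hzero] at h

end StoneGroup

/-! ### Hilbert tensor products: unitary extension and self-adjointness of `A ⊗ I` and `I ⊗ B` -/

section Tensor

variable {E F : Type*} [NormedAddCommGroup E] [InnerProductSpace ℂ E]
  [NormedAddCommGroup F] [InnerProductSpace ℂ F]

theorem norm_prodVec (x : E) (y : F) : ‖prodVec x y‖ = ‖x‖ * ‖y‖ := by
  rw [prodVec, UniformSpace.Completion.norm_coe, TensorProduct.norm_tmul]

/-- The bilinear map `(x, y) ↦ x ⊗ y`. -/
def prodVecₗ (E F : Type*) [NormedAddCommGroup E] [InnerProductSpace ℂ E]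
    [NormedAddCommGroup F] [InnerProductSpace ℂ F] : E →ₗ[ℂ] F →ₗ[ℂ] HilbertTensor E F :=
  (TensorProduct.mk ℂ E F).compr₂
    (UniformSpace.Completion.toComplₗᵢ (𝕜 := ℂ) (E := E ⊗[ℂ] F)).toLinearMap

theorem prodVecₗ_apply (x : E) (y : F) : prodVecₗ E F x y = prodVec x y := rfl

/-- The continuous linear map `x ↦ x ⊗ y`. -/
def prodVecLeft (y : F) : E →L[ℂ] HilbertTensor E F :=
  ((prodVecₗ E F).flip y).mkContinuous ‖y‖ fun x => by
    rw [LinearMap.flip_apply, prodVecₗ_apply, norm_prodVec, mul_comm]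

/-- The continuous linear map `y ↦ x ⊗ y`. -/
def prodVecRight (x : E) : F →L[ℂ] HilbertTensor E F :=
  (prodVecₗ E F x).mkContinuous ‖x‖ fun y => by
    rw [prodVecₗ_apply, norm_prodVec]

theorem prodVecLeft_apply (x : E) (y : F) : prodVecLeft y x = prodVec x y := rfl

theorem prodVecRight_apply (x : E) (y : F) : prodVecRight x y = prodVec x y := rfl

/-- A map with the inner products of product vectors and with total range extends to a unitary
map on the Hilbert tensor product. -/
theorem exists_tensorEquiv {G : Type*} [NormedAddCommGroup G] [InnerProductSpace ℂ G]
    [CompleteSpace G] (b : E →ₗ[ℂ] F →ₗ[ℂ] G)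
    (hb : ∀ x x' y y', inner ℂ (b x y) (b x' y') = inner ℂ x x' * inner ℂ y y')
    (hd : (Submodule.span ℂ {z | ∃ x y, b x y = z}).topologicalClosure = ⊤) :
    ∃ Φ : HilbertTensor E F ≃ₗᵢ[ℂ] G, ∀ x y, Φ (prodVec x y) = b x y := by
  have hinner : ∀ v w : E ⊗[ℂ] F, inner ℂ (TensorProduct.lift b v) (TensorProduct.lift b w) =
      inner ℂ v w := by
    intro v w
    induction v using TensorProduct.induction_on with
    | zero => simp
    | add a c ha hc => rw [map_add, inner_add_left, inner_add_left, ha, hc]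
    | tmul x y =>
      induction w using TensorProduct.induction_on with
      | zero => simp
      | add a c ha hc => rw [map_add, inner_add_right, inner_add_right, ha, hc]
      | tmul x' y' => rw [TensorProduct.lift.tmul, TensorProduct.lift.tmul, hb,
          TensorProduct.inner_tmul]
  let f : E ⊗[ℂ] F →ₗᵢ[ℂ] G := (TensorProduct.lift b).isometryOfInner hinner
  let i : E ⊗[ℂ] F →L[ℂ] HilbertTensor E F := UniformSpace.Completion.toComplL
  have hi : DenseRange i := UniformSpace.Completion.denseRange_coe
  have hu : IsUniformInducing i := UniformSpace.Completion.isUniformInducing_coe _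
  let g : HilbertTensor E F →L[ℂ] G := f.toContinuousLinearMap.extend i
  have hg : ∀ v : E ⊗[ℂ] F, g (v : HilbertTensor E F) = f v := fun v =>
    ContinuousLinearMap.extend_eq _ hi hu v
  have hnorm : ∀ v, ‖g v‖ = ‖v‖ := by
    intro v
    induction v using UniformSpace.Completion.induction_on with
    | hp => exact isClosed_eq g.continuous.norm continuous_norm
    | ih a => rw [hg, f.norm_map, UniformSpace.Completion.norm_coe]
  let h : HilbertTensor E F →ₗᵢ[ℂ] G := ⟨g.toLinearMap, hnorm⟩
  have hprod : ∀ x y, h (prodVec x y) = b x y := fun x y =>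
    (hg _).trans (TensorProduct.lift.tmul x y)
  -- An isometry of a complete space has closed range, so a total range is everything.
  have hclosed : IsClosed (LinearMap.range h.toLinearMap : Set G) :=
    h.isometry.isClosedEmbedding.isClosed_range
  have hsurj : LinearMap.range h.toLinearMap = ⊤ := by
    rw [eq_top_iff, ← hd]
    refine Submodule.topologicalClosure_minimal _ (Submodule.span_le.2 ?_) hclosed
    rintro _ ⟨x, y, rfl⟩
    exact ⟨prodVec x y, hprod x y⟩
  exact ⟨LinearIsometryEquiv.ofSurjective h (LinearMap.range_eq_top.1 hsurj), hprod⟩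

theorem eq_zero_of_inner_graph {u v : E} (h : inner ℂ (-u) u = inner ℂ v v) :
    u = 0 ∧ v = 0 := by
  rw [inner_neg_left, inner_self_eq_norm_sq_to_K, inner_self_eq_norm_sq_to_K] at h
  have h1 : -(‖u‖ ^ 2) = ‖v‖ ^ 2 := by exact_mod_cast h
  constructor
  · exact norm_eq_zero.1 (pow_eq_zero_iff two_ne_zero |>.1 (by nlinarith [sq_nonneg ‖u‖, sq_nonneg ‖v‖]))
  · exact norm_eq_zero.1 (pow_eq_zero_iff two_ne_zero |>.1 (by nlinarith [sq_nonneg ‖u‖, sq_nonneg ‖v‖]))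

/-- The converse of the criterion `topologicalClosure_eq_adjoint`: an adjoint that is itself
symmetric has no solution of `G* u = v`, `G* v = -u`, as this would give `-‖u‖² = ‖v‖²`. -/
theorem eq_zero_of_mem_adjoint {G : Submodule ℂ (E × E)} (hG : G.topologicalClosure = G.adjoint)
    {u v : E} (h1 : (u, v) ∈ G.adjoint) (h2 : (v, -u) ∈ G.adjoint) : u = 0 ∧ v = 0 := by
  have h3 : (u, v) ∈ G.adjoint.adjoint := by
    rw [← hG, adjoint_topologicalClosure]
    exact h1
  exact eq_zero_of_inner_graph (mem_adjoint.1 h3 _ h2)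

/-- The span of the pairs `(x ⊗ y, x' ⊗ y)` with `(x, x')` in `G` and `y` in `D`. -/
def leftGraph (G : Submodule ℂ (E × E)) (D : Submodule ℂ F) :
    Submodule ℂ (HilbertTensor E F × HilbertTensor E F) :=
  Submodule.span ℂ {p | ∃ q ∈ G, ∃ y ∈ D, p = (prodVec q.1 y, prodVec q.2 y)}

/-- The span of the pairs `(x ⊗ y, x ⊗ y')` with `(y, y')` in `G`. -/
def rightGraph (E : Type*) [NormedAddCommGroup E] [InnerProductSpace ℂ E]
    (G : Submodule ℂ (F × F)) : Submodule ℂ (HilbertTensor E F × HilbertTensor E F) :=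
  Submodule.span ℂ {p | ∃ x : E, ∃ q ∈ G, p = (prodVec x q.1, prodVec x q.2)}

theorem mem_leftGraph_adjoint {G : Submodule ℂ (E × E)} {D : Submodule ℂ F}
    {p : HilbertTensor E F × HilbertTensor E F} : p ∈ (leftGraph G D).adjoint ↔
      ∀ q ∈ G, ∀ y ∈ D, inner ℂ (prodVec q.2 y) p.1 = inner ℂ (prodVec q.1 y) p.2 := by
  rw [leftGraph, mem_adjoint_span]
  constructor
  · exact fun h q hq y hy => h _ ⟨q, hq, y, hy, rfl⟩
  · rintro h _ ⟨q, hq, y, hy, rfl⟩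
    exact h q hq y hy

theorem mem_rightGraph_adjoint {G : Submodule ℂ (F × F)}
    {p : HilbertTensor E F × HilbertTensor E F} : p ∈ (rightGraph E G).adjoint ↔
      ∀ x : E, ∀ q ∈ G, inner ℂ (prodVec x q.2) p.1 = inner ℂ (prodVec x q.1) p.2 := by
  rw [rightGraph, mem_adjoint_span]
  constructor
  · exact fun h x q hq => h _ ⟨x, q, hq, rfl⟩
  · rintro h _ ⟨x, q, hq, rfl⟩
    exact h x q hq

/-- The adjoint of `x ↦ x ⊗ y` slices a vector of the tensor product into `E`. Slicing turns a
deficiency pair of the left graph into one of `G`, which is zero; the slices by a dense set of `y`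
determine the vector. -/
theorem leftGraph_topologicalClosure [CompleteSpace E] {G : Submodule ℂ (E × E)}
    (hG : G.topologicalClosure = G.adjoint) {D : Submodule ℂ F} (hD : Dense (D : Set F)) :
    (leftGraph G D).topologicalClosure = (leftGraph G D).adjoint := by
  refine topologicalClosure_eq_adjoint ?_ fun u v h1 h2 => ?_
  · refine Submodule.span_le.2 ?_
    rintro _ ⟨q, hq, y, -, rfl⟩
    refine mem_leftGraph_adjoint.2 fun q' hq' y' _ => ?_
    have h := mem_adjoint.1 (hG ▸ G.le_topologicalClosure hq : q ∈ G.adjoint) q' hq'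
    simp only [inner_prodVec, h]
  · have key : ∀ y ∈ D, ContinuousLinearMap.adjoint (prodVecLeft (E := E) y) u = 0 ∧
        ContinuousLinearMap.adjoint (prodVecLeft (E := E) y) v = 0 := by
      intro y hy
      refine eq_zero_of_mem_adjoint hG (mem_adjoint.2 fun q hq => ?_)
        (mem_adjoint.2 fun q hq => ?_)
      · simp only [ContinuousLinearMap.adjoint_inner_right]
        exact mem_leftGraph_adjoint.1 h1 q hq y hy
      · rw [← map_neg]
        simp only [ContinuousLinearMap.adjoint_inner_right]
        exact mem_leftGraph_adjoint.1 h2 q hq y hy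
    constructor
    · refine eq_zero_of_inner_prodVec (D := ⊤) dense_univ hD _ fun x _ y hy => ?_
      rw [← prodVecLeft_apply, ← ContinuousLinearMap.adjoint_inner_right, (key y hy).1,
        inner_zero_right]
    · refine eq_zero_of_inner_prodVec (D := ⊤) dense_univ hD _ fun x _ y hy => ?_
      rw [← prodVecLeft_apply, ← ContinuousLinearMap.adjoint_inner_right, (key y hy).2,
        inner_zero_right]

theorem rightGraph_topologicalClosure [CompleteSpace F] {G : Submodule ℂ (F × F)}
    (hG : G.topologicalClosure = G.adjoint) :
    (rightGraph E G).topologicalClosure = (rightGraph E G).adjoint := by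
  refine topologicalClosure_eq_adjoint ?_ fun u v h1 h2 => ?_
  · refine Submodule.span_le.2 ?_
    rintro _ ⟨x, q, hq, rfl⟩
    refine mem_rightGraph_adjoint.2 fun x' q' hq' => ?_
    have h := mem_adjoint.1 (hG ▸ G.le_topologicalClosure hq : q ∈ G.adjoint) q' hq'
    simp only [inner_prodVec, h]
  · have key : ∀ x, ContinuousLinearMap.adjoint (prodVecRight (F := F) x) u = 0 ∧
        ContinuousLinearMap.adjoint (prodVecRight (F := F) x) v = 0 := by
      intro x
      refine eq_zero_of_mem_adjoint hG (mem_adjoint.2 fun q hq => ?_)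
        (mem_adjoint.2 fun q hq => ?_)
      · simp only [ContinuousLinearMap.adjoint_inner_right]
        exact mem_rightGraph_adjoint.1 h1 x q hq
      · rw [← map_neg]
        simp only [ContinuousLinearMap.adjoint_inner_right]
        exact mem_rightGraph_adjoint.1 h2 x q hq
    constructor
    · refine eq_zero_of_inner_prodVec (D := ⊤) (D' := ⊤) dense_univ dense_univ _
        fun x _ y _ => ?_
      rw [← prodVecRight_apply, ← ContinuousLinearMap.adjoint_inner_right, (key x).1,
        inner_zero_right]
    · refine eq_zero_of_inner_prodVec (D := ⊤) (D' := ⊤) dense_univ dense_univ _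
        fun x _ y _ => ?_
      rw [← prodVecRight_apply, ← ContinuousLinearMap.adjoint_inner_right, (key x).2,
        inner_zero_right]

theorem tensorGraph_le_adjoint {A : E →ₗ.[ℂ] E} {B : F →ₗ.[ℂ] F}
    (hA : A.IsFormalAdjoint A) (hB : B.IsFormalAdjoint B) :
    tensorGraph A B ≤ (tensorGraph A B).adjoint := by
  refine Submodule.span_le.2 ?_
  rintro _ ⟨x, y, rfl⟩
  refine mem_adjoint_span.2 ?_
  rintro _ ⟨x', y', rfl⟩
  simp only [inner_prodVec]
  rw [hA x' x, hB y' y]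

/-- If the algebraic tensor product of two densely defined symmetric operators extends an
essentially self-adjoint relation, then `A ⊗ B` is self-adjoint. -/
theorem tensorOp_graph_eq_adjoint {A : E →ₗ.[ℂ] E} {B : F →ₗ.[ℂ] F}
    (hA : Dense (A.domain : Set E)) (hB : Dense (B.domain : Set F))
    (hA' : A.IsFormalAdjoint A) (hB' : B.IsFormalAdjoint B)
    {D : Submodule ℂ (HilbertTensor E F × HilbertTensor E F)} (hD : D ≤ tensorGraph A B)
    (hD' : D.topologicalClosure = D.adjoint) :
    (tensorOp A B).graph = D.adjoint := by
  rw [tensorOp_graph hA hB hA' hB']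
  -- The closure of the tensor graph lies between the closure of `D` and the adjoint of `D`, and
  -- these coincide.
  refine le_antisymm ?_ ?_
  · exact Submodule.topologicalClosure_minimal _
      ((tensorGraph_le_adjoint hA' hB').trans (adjoint_antitone hD)) (isClosed_adjoint _)
  · rw [← hD']
    exact Submodule.topologicalClosure_mono hD

theorem idOp_isFormalAdjoint : (idOp E).IsFormalAdjoint (idOp E) := fun _ _ => rfl

theorem dense_domain_idOp : Dense ((idOp E).domain : Set E) := dense_univ

theorem isFormalAdjoint_of_graph_le {A : E →ₗ.[ℂ] E} (h : A.graph ≤ A.graph.adjoint) :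
    A.IsFormalAdjoint A := fun x y => mem_adjoint.1 (h (A.mem_graph y)) _ (A.mem_graph x)

theorem graph_conj (U : E ≃ₗᵢ[ℂ] F) (A : E →ₗ.[ℂ] E) :
    (conj U A).graph = A.graph.map ((U.toLinearEquiv.prodCongr U.toLinearEquiv) :
      E × E →ₗ[ℂ] F × F) := by
  ext p
  rw [mem_graph_conj]
  constructor
  · intro h
    exact ⟨_, h, Prod.ext (U.apply_symm_apply _) (U.apply_symm_apply _)⟩
  · rintro ⟨q, hq, rfl⟩
    simpa using hq

theorem adjoint_map (U : E ≃ₗᵢ[ℂ] F) (D : Submodule ℂ (E × E)) :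
    (D.map ((U.toLinearEquiv.prodCongr U.toLinearEquiv) : E × E →ₗ[ℂ] F × F)).adjoint =
      D.adjoint.map ((U.toLinearEquiv.prodCongr U.toLinearEquiv) : E × E →ₗ[ℂ] F × F) := by
  ext p
  have hU : ∀ (x : E) (y : F), inner ℂ (U x) y = inner ℂ x (U.symm y) := fun x y => by
    rw [← U.inner_map_map x, U.apply_symm_apply]
  constructor
  · intro h
    refine ⟨(U.symm p.1, U.symm p.2), mem_adjoint.2 fun q hq => ?_,
      Prod.ext (U.apply_symm_apply _) (U.apply_symm_apply _)⟩
    have h1 := mem_adjoint.1 h (U q.1, U q.2) ⟨q, hq, rfl⟩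
    rw [hU, hU] at h1
    exact h1
  · rintro ⟨q, hq, rfl⟩
    refine mem_adjoint.2 ?_
    rintro _ ⟨r, hr, rfl⟩
    have h1 := mem_adjoint.1 hq r hr
    rw [← U.inner_map_map, ← U.inner_map_map r.1] at h1
    exact h1

theorem topologicalClosure_map (U : E ≃ₗᵢ[ℂ] F) (D : Submodule ℂ (E × E)) :
    (D.map ((U.toLinearEquiv.prodCongr U.toLinearEquiv) : E × E →ₗ[ℂ] F × F)).topologicalClosure =
      D.topologicalClosure.map
        ((U.toLinearEquiv.prodCongr U.toLinearEquiv) : E × E →ₗ[ℂ] F × F) := by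
  apply SetLike.coe_injective
  have h := (U.toHomeomorph.prodCongr U.toHomeomorph).image_closure (D : Set (E × E))
  exact h.symm

end Tensor

/-! ### Test functions in `L²(ℝ)` and the weak equation `g' = -c g` -/

section TestFunctions

/-- A test function as an element of `L²(ℝ)`. -/
def testVec (φ : ℝ → ℝ) (h : ContDiff ℝ ∞ φ) (hs : HasCompactSupport φ) : L2R :=
  ((Complex.continuous_ofReal.comp h.continuous).memLp_of_hasCompactSupport
    (hs.comp_left (g := ((↑) : ℝ → ℂ)) Complex.ofReal_zero) :
    MemLp (fun τ => (φ τ : ℂ)) 2 volume).toLp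

variable {φ : ℝ → ℝ} (h : ContDiff ℝ ∞ φ) (hs : HasCompactSupport φ)

theorem coeFn_testVec : testVec φ h hs =ᵐ[volume] fun τ => (φ τ : ℂ) := MemLp.coeFn_toLp _

theorem contDiff_deriv {φ : ℝ → ℝ} (h : ContDiff ℝ ∞ φ) : ContDiff ℝ ∞ (deriv φ) :=
  (contDiff_infty_iff_deriv.1 h).2

theorem inner_testVec (f : L2R) : inner ℂ (testVec φ h hs) f = ∫ τ, φ τ • f τ := by
  rw [L2.inner_def]
  refine integral_congr_ae ?_
  filter_upwards [coeFn_testVec h hs] with τ hτ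
  rw [hτ, RCLike.inner_apply, Complex.conj_ofReal, Complex.real_smul, mul_comm]

theorem eq_zero_of_inner_testVec {f : L2R}
    (hf : ∀ φ (h : ContDiff ℝ ∞ φ) (hs : HasCompactSupport φ), inner ℂ (testVec φ h hs) f = 0) :
    f = 0 := by
  have h1 : LocallyIntegrable (f : ℝ → ℂ) volume := (Lp.memLp f).locallyIntegrable (by norm_num)
  refine (Lp.eq_zero_iff_ae_eq_zero).mpr
    (ae_eq_zero_of_integral_contDiff_smul_eq_zero h1 fun φ c s => ?_)
  rw [← inner_testVec c s]
  exact hf φ c s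

theorem dense_of_testVec_mem {D : Submodule ℂ L2R}
    (hD : ∀ φ (h : ContDiff ℝ ∞ φ) (hs : HasCompactSupport φ), testVec φ h hs ∈ D) :
    Dense (D : Set L2R) := by
  rw [Submodule.dense_iff_topologicalClosure_eq_top, Submodule.topologicalClosure_eq_top_iff,
    Submodule.eq_bot_iff]
  exact fun f hf => eq_zero_of_inner_testVec fun φ h hs => (D.mem_orthogonal f).1 hf _ (hD φ h hs)

theorem integral_deriv_smul_eq_neg {φ : ℝ → ℝ} (h : ContDiff ℝ ∞ φ) (hs : HasCompactSupport φ)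
    {g g' : ℝ → ℂ} (hg : ∀ τ, HasDerivAt g (g' τ) τ) (hg' : Continuous g') :
    ∫ τ, deriv φ τ • g τ = -∫ τ, φ τ • g' τ := by
  have hc : Continuous g := continuous_iff_continuousAt.2 fun τ => (hg τ).continuousAt
  have hφ' : Continuous (deriv φ) := (contDiff_deriv h).continuous
  have i1 : Integrable (fun τ => deriv φ τ • g τ) :=
    (hφ'.smul hc).integrable_of_hasCompactSupport hs.deriv.smul_right
  have i2 : Integrable (fun τ => φ τ • g' τ) :=
    (h.continuous.smul hg').integrable_of_hasCompactSupport hs.smul_right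
  have i3 : Integrable (fun τ => φ τ • g τ) :=
    (h.continuous.smul hc).integrable_of_hasCompactSupport hs.smul_right
  have hd : ∀ τ, HasDerivAt (fun τ => φ τ • g τ) (φ τ • g' τ + deriv φ τ • g τ) τ := fun τ =>
    ((h.differentiable (by simp)) τ).hasDerivAt.smul (hg τ)
  have := integral_eq_zero_of_hasDerivAt_of_integrable hd (i2.add i1) i3
  rw [integral_add i2 i1] at this
  exact eq_neg_of_add_eq_zero_right this

/-- The weak equation `g' = -c g` has no nonzero solution in `L²`. The function `u t = ∫ φ(τ - t)
g(τ) dτ` solves `u' = -c u` classically and is bounded by Cauchy-Schwarz, while `exp (c t) u t` is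
constant; sending `c t` to `-∞` gives `u 0 = 0`. -/
theorem eq_zero_of_integral_deriv_smul {g : L2R} {c : ℝ} (hc : c ≠ 0)
    (hg : ∀ φ : ℝ → ℝ, ContDiff ℝ ∞ φ → HasCompactSupport φ →
      ∫ τ, deriv φ τ • g τ = c * ∫ τ, φ τ • g τ) : g = 0 := by
  refine eq_zero_of_inner_testVec fun φ h hs => ?_
  have hloc : LocallyIntegrable (g : ℝ → ℂ) volume := (Lp.memLp g).locallyIntegrable (by norm_num)
  have ht : ∀ t : ℝ, ContDiff ℝ ∞ (fun τ => φ (τ - t)) := fun t =>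
    h.comp (contDiff_id.sub contDiff_const)
  have hst : ∀ t : ℝ, HasCompactSupport (fun τ => φ (τ - t)) := fun t =>
    hs.comp_homeomorph (Homeomorph.subRight t)
  let k : ℝ → ℝ := fun s => φ (-s)
  have hk : ContDiff ℝ ∞ k := h.comp contDiff_neg
  have hks : HasCompactSupport k := hs.comp_homeomorph (Homeomorph.neg ℝ)
  let u : ℝ → ℂ := fun t => ∫ τ, φ (τ - t) • g τ
  have hu : ∀ t, HasDerivAt u (-c * u t) t := by
    intro t
    have h1 := hks.hasDerivAt_convolution_right ((ContinuousLinearMap.lsmul ℝ ℝ).flip : ℂ →L[ℝ] ℝ →L[ℝ] ℂ)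
      hloc (hk.of_le (by simp)) t
    have e1 : (MeasureTheory.convolution (g : ℝ → ℂ) k
        ((ContinuousLinearMap.lsmul ℝ ℝ).flip : ℂ →L[ℝ] ℝ →L[ℝ] ℂ) volume) = u := by
      funext s
      simp only [convolution_def, k, u, neg_sub]
      rfl
    rw [e1] at h1
    refine h1.congr_deriv ?_
    rw [convolution_def]
    have e2 : ∀ τ, deriv k (t - τ) = -deriv (fun τ => φ (τ - t)) τ := by
      intro τ
      rw [deriv_comp_sub_const]
      simp only [k]
      rw [deriv_comp_neg, neg_sub]
    have e3 : ∀ τ, (((ContinuousLinearMap.lsmul ℝ ℝ).flip : ℂ →L[ℝ] ℝ →L[ℝ] ℂ) (g τ))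
        (deriv k (t - τ)) = -(deriv (fun τ => φ (τ - t)) τ • g τ) := by
      intro τ
      rw [e2, ← neg_smul]
      rfl
    simp only [e3]
    rw [integral_neg, hg _ (ht t) (hst t), neg_mul]
  have hbound : ∀ t, ‖u t‖ ≤ ‖testVec φ h hs‖ * ‖g‖ := by
    intro t
    have e1 : u t = inner ℂ (testVec _ (ht t) (hst t)) g := (inner_testVec _ _ _).symm
    have e2 : ‖testVec _ (ht t) (hst t)‖ = ‖testVec φ h hs‖ := by
      have hmp : MeasurePreserving (fun τ : ℝ => τ - t) volume volume :=
        measurePreserving_sub_right volume t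
      rw [testVec, testVec, Lp.norm_toLp, Lp.norm_toLp]
      congr 1
      exact eLpNorm_comp_measurePreserving
        (Complex.continuous_ofReal.comp h.continuous).aestronglyMeasurable hmp
    rw [e1, ← e2]
    exact norm_inner_le_norm _ _
  have hv : ∀ t, Real.exp (c * t) • u t = u 0 := by
    have hd : ∀ t, HasDerivAt (fun t => Real.exp (c * t) • u t) 0 t := by
      intro t
      have h1 : HasDerivAt (fun t => Real.exp (c * t)) (Real.exp (c * t) * c) t := by
        simpa using ((hasDerivAt_id t).const_mul c).exp
      refine (h1.smul (hu t)).congr_deriv ?_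
      simp only [Complex.real_smul, Complex.ofReal_mul]
      ring
    intro t
    have := is_const_of_deriv_eq_zero (fun t => (hd t).differentiableAt) (fun t => (hd t).deriv) t 0
    simpa using this
  have hlim : Filter.Tendsto (fun s : ℝ => Real.exp (-s) * (‖testVec φ h hs‖ * ‖g‖))
      Filter.atTop (nhds 0) := by
    simpa using Real.tendsto_exp_neg_atTop_nhds_zero.mul_const (‖testVec φ h hs‖ * ‖g‖)
  have hle : ‖u 0‖ ≤ 0 := by
    refine ge_of_tendsto hlim (Filter.Eventually.of_forall fun s => ?_)
    -- At `t = -s / c` the factor `exp (c t)` is `exp (-s)`, whatever the sign of `c`.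
    have h1 := hv (-s / c)
    rw [mul_div_cancel₀ _ hc] at h1
    rw [← h1, norm_smul, Real.norm_eq_abs, abs_of_pos (Real.exp_pos _)]
    exact mul_le_mul_of_nonneg_left (hbound _) (Real.exp_pos _).le
  rw [inner_testVec]
  have h0 : u 0 = 0 := norm_le_zero_iff.1 hle
  simpa [u] using h0

end TestFunctions

/-! ### Essential self-adjointness of `-iħ d/dτ` on test functions -/

section Momentum

/-- The graph of `-iħ d/dτ` on test functions. -/
def testGraph (ħ : ℝ) : Submodule ℂ (L2R × L2R) :=
  Submodule.span ℂ {p | ∃ (φ : ℝ → ℝ) (h : ContDiff ℝ ∞ φ) (hs : HasCompactSupport φ),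
    p = (testVec φ h hs, -(Complex.I * ħ) • testVec (deriv φ) (contDiff_deriv h) hs.deriv)}

theorem testVec_mem_testGraph (ħ : ℝ) {φ : ℝ → ℝ} (h : ContDiff ℝ ∞ φ)
    (hs : HasCompactSupport φ) :
    (testVec φ h hs, -(Complex.I * ħ) • testVec (deriv φ) (contDiff_deriv h) hs.deriv) ∈
      testGraph ħ :=
  Submodule.subset_span ⟨φ, h, hs, rfl⟩

/-- Pairing with the graph over test functions is exactly the defining condition of the weak
derivative. -/
theorem testGraph_adjoint (ħ : ℝ) : (testGraph ħ).adjoint = momentumGraph ħ := by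
  have key : ∀ (p : L2R × L2R) {φ : ℝ → ℝ} (h : ContDiff ℝ ∞ φ) (hs : HasCompactSupport φ),
      inner ℂ (-(Complex.I * ħ) • testVec (deriv φ) (contDiff_deriv h) hs.deriv) p.1 =
        Complex.I * ħ * ∫ τ, deriv φ τ • p.1 τ := fun p φ h hs => by
    rw [inner_smul_left, inner_testVec]
    simp
  ext p
  rw [testGraph, mem_adjoint_span]
  constructor
  · intro H φ h hs
    have := H _ ⟨φ, h, hs, rfl⟩
    rw [key p h hs, inner_testVec h hs] at this
    exact this.symm
  · rintro H _ ⟨φ, h, hs, rfl⟩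
    rw [key p h hs, inner_testVec h hs]
    exact (H φ h hs).symm

theorem testGraph_le_momentumGraph (ħ : ℝ) : testGraph ħ ≤ momentumGraph ħ := by
  refine Submodule.span_le.2 ?_
  rintro _ ⟨ψ, h, hs, rfl⟩
  intro φ hφ hφs
  have hψ : ∀ τ, HasDerivAt (fun τ => (ψ τ : ℂ)) ((deriv ψ τ : ℝ) : ℂ) τ := fun τ =>
    ((h.differentiable (by simp)) τ).hasDerivAt.ofReal_comp
  have h1 := integral_deriv_smul_eq_neg hφ hφs hψ
    (Complex.continuous_ofReal.comp (contDiff_deriv h).continuous)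
  have h2 : ∫ τ, deriv φ τ • (testVec ψ h hs) τ = ∫ τ, deriv φ τ • (ψ τ : ℂ) := by
    refine integral_congr_ae ?_
    filter_upwards [coeFn_testVec h hs] with τ hτ
    rw [hτ]
  have h3 : ∫ τ, φ τ • (-(Complex.I * ħ) • testVec (deriv ψ) (contDiff_deriv h) hs.deriv : L2R) τ =
      -(Complex.I * ħ) * ∫ τ, φ τ • ((deriv ψ τ : ℝ) : ℂ) := by
    rw [← integral_const_mul]
    refine integral_congr_ae ?_
    filter_upwards [coeFn_testVec (contDiff_deriv h) hs.deriv, Lp.coeFn_smul (-(Complex.I * ħ))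
      (testVec (deriv ψ) (contDiff_deriv h) hs.deriv)] with τ h4 h5
    rw [h5, Pi.smul_apply, h4, smul_eq_mul, Complex.real_smul, Complex.real_smul, mul_left_comm]
  simp only
  rw [h2, h3, h1]
  ring

/-- A deficiency pair satisfies `-iħ u' = v` and `-iħ v' = -u` weakly. The combinations `u + i s v`
with `s = ±1` decouple this into `w' = (s/ħ) w`, which has only the zero solution in `L²`. -/
theorem testGraph_topologicalClosure {ħ : ℝ} (hħ : ħ ≠ 0) :
    (testGraph ħ).topologicalClosure = (testGraph ħ).adjoint := by
  refine topologicalClosure_eq_adjoint ?_ fun u v h1 h2 => ?_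
  · rw [testGraph_adjoint]
    exact testGraph_le_momentumGraph ħ
  rw [testGraph_adjoint] at h1 h2
  have hħ' : (ħ : ℂ) ≠ 0 := by exact_mod_cast hħ
  have key : ∀ s : ℝ, s ≠ 0 → s * s = 1 → u + (Complex.I * s) • v = 0 := by
    intro s hs hs2
    refine eq_zero_of_integral_deriv_smul (c := -s / ħ) (div_ne_zero (neg_ne_zero.2 hs) hħ)
      fun φ h hφ => ?_
    have a1 := h1 φ h hφ
    have a2 := h2 φ h hφ
    simp only [← inner_testVec h hφ, ← inner_testVec (contDiff_deriv h) hφ.deriv,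
      inner_add_right, inner_smul_right, inner_neg_right] at a1 a2 ⊢
    have hs2' : (s : ℂ) * s = 1 := by exact_mod_cast hs2
    have e : (ħ : ℂ) * (inner ℂ (testVec (deriv φ) (contDiff_deriv h) hφ.deriv) u +
        Complex.I * s * inner ℂ (testVec (deriv φ) (contDiff_deriv h) hφ.deriv) v) =
        (-s) * (inner ℂ (testVec φ h hφ) u + Complex.I * s * inner ℂ (testVec φ h hφ) v) := by
      linear_combination Complex.I * a1 - (s : ℂ) * a2 + Complex.I *
        inner ℂ (testVec φ h hφ) v * hs2' + ħ * inner ℂ (testVec (deriv φ) (contDiff_deriv h) hφ.deriv) u *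
          Complex.I_mul_I
    push_cast
    rw [div_mul_eq_mul_div, eq_div_iff hħ', mul_comm]
    exact e
  have k1 := key 1 one_ne_zero (by norm_num)
  have k2 := key (-1) (by norm_num) (by norm_num)
  have k3 : (2 : ℂ) • u = 0 := by
    have : (2 : ℂ) • u = (u + (Complex.I * (1 : ℝ)) • v) + (u + (Complex.I * (-1 : ℝ)) • v) := by
      push_cast
      rw [two_smul, mul_one, mul_neg_one, neg_smul]
      abel
    rw [this, k1, k2, add_zero]
  have hu : u = 0 := (smul_eq_zero.1 k3).resolve_left two_ne_zero
  refine ⟨hu, ?_⟩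
  rw [hu, zero_add] at k1
  exact (smul_eq_zero.1 k1).resolve_left (by simp)

end Momentum

/-! ### The time operator and the clock Hamiltonian on a clock space -/

section ClockOperators

variable {Hc : Type*} [NormedAddCommGroup Hc] [InnerProductSpace ℂ Hc] (c : IdealClock Hc)

theorem mem_graph_mulTau {p : L2R × L2R} :
    p ∈ mulTau.graph ↔ p.2 =ᵐ[volume] fun τ => (τ : ℂ) * p.1 τ := by
  obtain ⟨f, g⟩ := p
  rw [LinearPMap.mem_graph_iff]
  constructor
  · rintro ⟨⟨x, hx⟩, rfl, rfl⟩
    exact MemLp.coeFn_toLp hx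
  · intro h
    have hf : MemLp (fun τ : ℝ => (τ : ℂ) * f τ) 2 volume := (Lp.memLp g).ae_eq h
    refine ⟨⟨f, hf⟩, rfl, ?_⟩
    exact Lp.ext ((MemLp.coeFn_toLp hf).trans h.symm)

theorem mulTau_graph_le_adjoint : mulTau.graph ≤ mulTau.graph.adjoint := by
  refine fun p hp => mem_adjoint.2 fun q hq => ?_
  rw [mem_graph_mulTau] at hp hq
  rw [L2.inner_def, L2.inner_def]
  refine integral_congr_ae ?_
  filter_upwards [hp, hq] with τ h1 h2
  rw [h1, h2]
  simp only [RCLike.inner_apply, map_mul, Complex.conj_ofReal]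
  ring

theorem contDiff_id_mul {φ : ℝ → ℝ} (h : ContDiff ℝ ∞ φ) : ContDiff ℝ ∞ (fun τ => τ * φ τ) :=
  contDiff_id.mul h

theorem testVec_mem_graph_mulTau {φ : ℝ → ℝ} (h : ContDiff ℝ ∞ φ) (hs : HasCompactSupport φ) :
    (testVec φ h hs, testVec _ (contDiff_id_mul h) hs.mul_left) ∈ mulTau.graph := by
  rw [mem_graph_mulTau]
  filter_upwards [coeFn_testVec h hs, coeFn_testVec (contDiff_id_mul h) hs.mul_left] with τ h1 h2
  rw [h1, h2]
  push_cast
  rfl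

theorem map_graph_le_adjoint {E F : Type*} [NormedAddCommGroup E] [InnerProductSpace ℂ E]
    [NormedAddCommGroup F] [InnerProductSpace ℂ F] (U : E ≃ₗᵢ[ℂ] F) {A : E →ₗ.[ℂ] E}
    (h : A.graph ≤ A.graph.adjoint) : (conj U A).graph ≤ (conj U A).graph.adjoint := by
  rw [graph_conj, adjoint_map]
  exact Submodule.map_mono h

theorem dense_domain_conj {E F : Type*} [NormedAddCommGroup E] [InnerProductSpace ℂ E]
    [NormedAddCommGroup F] [InnerProductSpace ℂ F] (U : E ≃ₗᵢ[ℂ] F) {A : E →ₗ.[ℂ] E}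
    (h : Dense (A.domain : Set E)) : Dense ((conj U A).domain : Set F) :=
  h.preimage U.symm.toHomeomorph.isOpenMap

namespace IdealClock

/-- The clock state whose readings are a given test function. -/
def testState {φ : ℝ → ℝ} (h : ContDiff ℝ ∞ φ) (hs : HasCompactSupport φ) : Hc :=
  c.reading.symm (testVec φ h hs)

/-- The graph of the clock Hamiltonian on states given by test functions. -/
def testGraph (ħ : ℝ) : Submodule ℂ (Hc × Hc) :=
  (PageWootters.testGraph ħ).map ((c.reading.symm.toLinearEquiv.prodCongr
    c.reading.symm.toLinearEquiv) : L2R × L2R →ₗ[ℂ] Hc × Hc)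

theorem timeOp_isFormalAdjoint : c.timeOp.IsFormalAdjoint c.timeOp :=
  isFormalAdjoint_of_graph_le (map_graph_le_adjoint _ mulTau_graph_le_adjoint)

theorem dense_domain_timeOp : Dense (c.timeOp.domain : Set Hc) :=
  dense_domain_conj _ (dense_of_testVec_mem fun _ h hs =>
    LinearPMap.mem_domain_of_mem_graph (testVec_mem_graph_mulTau h hs))

theorem testState_mem_graph_timeOp {φ : ℝ → ℝ} (h : ContDiff ℝ ∞ φ) (hs : HasCompactSupport φ) :
    (c.testState h hs, c.testState (contDiff_id_mul h) hs.mul_left) ∈ c.timeOp.graph := by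
  rw [timeOp, graph_conj]
  exact ⟨_, testVec_mem_graph_mulTau h hs, rfl⟩

theorem testGraph_adjoint (ħ : ℝ) : (c.testGraph ħ).adjoint = (c.hamiltonian ħ).graph := by
  rw [testGraph, adjoint_map, PageWootters.testGraph_adjoint, hamiltonian, graph_conj,
    momentum_graph]

theorem testGraph_topologicalClosure {ħ : ℝ} (hħ : ħ ≠ 0) :
    (c.testGraph ħ).topologicalClosure = (c.testGraph ħ).adjoint := by
  rw [testGraph, adjoint_map, topologicalClosure_map, PageWootters.testGraph_topologicalClosure hħ]

theorem testGraph_le {ħ : ℝ} (hħ : ħ ≠ 0) : c.testGraph ħ ≤ (c.hamiltonian ħ).graph := by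
  rw [← c.testGraph_adjoint, ← c.testGraph_topologicalClosure hħ]
  exact Submodule.le_topologicalClosure _

theorem hamiltonian_isFormalAdjoint {ħ : ℝ} (hħ : ħ ≠ 0) :
    (c.hamiltonian ħ).IsFormalAdjoint (c.hamiltonian ħ) := by
  refine isFormalAdjoint_of_graph_le ?_
  rw [← c.testGraph_adjoint]
  conv_rhs => rw [← c.testGraph_topologicalClosure hħ, adjoint_topologicalClosure]

theorem dense_domain_hamiltonian (ħ : ℝ) : Dense ((c.hamiltonian ħ).domain : Set Hc) := by
  refine dense_domain_conj _ (dense_of_testVec_mem fun _ h hs =>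
    LinearPMap.mem_domain_of_mem_graph (y := -(Complex.I * ħ) • testVec _ (contDiff_deriv h) hs.deriv) ?_)
  rw [momentum_graph]
  exact testGraph_le_momentumGraph ħ (testVec_mem_testGraph ħ h hs)

variable {F : Type*} [NormedAddCommGroup F] [InnerProductSpace ℂ F]

/-- The dense subspace `D` is left free because two cores are needed: `D` the domain of the world
Hamiltonian, where the sum can be computed, and `D = ⊤` for zero world Hamiltonian. -/
theorem tensorOp_hamiltonian_idOp_graph [CompleteSpace Hc] {ħ : ℝ} (hħ : ħ ≠ 0)
    {D : Submodule ℂ F} (hD : Dense (D : Set F)) :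
    (tensorOp (c.hamiltonian ħ) (idOp F)).graph = (leftGraph (c.testGraph ħ) D).adjoint := by
  refine tensorOp_graph_eq_adjoint (c.dense_domain_hamiltonian ħ) dense_domain_idOp
    (c.hamiltonian_isFormalAdjoint hħ) idOp_isFormalAdjoint ?_
    (leftGraph_topologicalClosure (c.testGraph_topologicalClosure hħ) hD)
  refine Submodule.span_le.2 ?_
  rintro _ ⟨q, hq, y, -, rfl⟩
  obtain ⟨x, hx1, hx2⟩ := LinearPMap.mem_graph_iff _ |>.1 (c.testGraph_le hħ hq)
  refine Submodule.subset_span ⟨x, ⟨y, Submodule.mem_top⟩, ?_⟩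
  rw [hx1, hx2]
  rfl

end IdealClock

theorem tensorOp_idOp_graph {E F : Type*} [NormedAddCommGroup E] [InnerProductSpace ℂ E]
    [NormedAddCommGroup F] [InnerProductSpace ℂ F] [CompleteSpace F] {A : F →ₗ.[ℂ] F}
    (hA : IsSelfAdjoint A) : (tensorOp (idOp E) A).graph = (rightGraph E A.graph).adjoint := by
  have hA' := graph_adjoint_of_isSelfAdjoint hA
  have hcl : A.graph.topologicalClosure = A.graph.adjoint := by
    rw [hA']
    exact IsClosed.submodule_topologicalClosure_eq hA.isClosed
  refine tensorOp_graph_eq_adjoint dense_domain_idOp hA.dense_domain idOp_isFormalAdjoint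
    (isFormalAdjoint_of_graph_le hA'.ge) ?_ (rightGraph_topologicalClosure hcl)
  refine Submodule.span_le.2 ?_
  rintro _ ⟨x, q, hq, rfl⟩
  obtain ⟨y, hy1, hy2⟩ := LinearPMap.mem_graph_iff _ |>.1 hq
  refine Submodule.subset_span ⟨⟨x, Submodule.mem_top⟩, y, ?_⟩
  rw [hy1, hy2]
  rfl

end ClockOperators

/-! ### The Hilbert tensor product as `L²(ℝ; F)` -/

section VectorValued

variable {F : Type*} [NormedAddCommGroup F] [InnerProductSpace ℂ F]

theorem norm_sq_eq_integral (g : Lp F 2 (volume : Measure ℝ)) :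
    ‖g‖ ^ 2 = ∫ τ, ‖g τ‖ ^ 2 := by
  rw [← inner_self_eq_norm_sq (𝕜 := ℂ) g, L2.inner_def, ← integral_re (L2.integrable_inner g g)]
  simp only [inner_self_eq_norm_sq]

/-- Dominated convergence in `L²`. -/
theorem tendsto_zero_of_dominated {ι : Type*} {l : Filter ι} [l.IsCountablyGenerated]
    {g : ι → Lp F 2 (volume : Measure ℝ)} {G : ι → ℝ → F} {b : ℝ → ℝ}
    (hgG : ∀ i, g i =ᵐ[volume] G i) (hb : Integrable fun τ => b τ ^ 2)
    (hG : ∀ i, ∀ᵐ τ, ‖G i τ‖ ≤ b τ) (hlim : ∀ᵐ τ, Filter.Tendsto (fun i => G i τ) l (nhds 0)) :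
    Filter.Tendsto g l (nhds 0) := by
  have h1 : Filter.Tendsto (fun i => ∫ τ, ‖G i τ‖ ^ 2) l (nhds (∫ _ : ℝ, (0 : ℝ))) := by
    refine tendsto_integral_filter_of_dominated_convergence (fun τ => b τ ^ 2)
      (Filter.Eventually.of_forall fun i => ?_) (Filter.Eventually.of_forall fun i => ?_) hb ?_
    · exact ((Lp.aestronglyMeasurable (g i)).congr (hgG i)).norm.pow 2
    · filter_upwards [hG i] with τ hτ
      rw [norm_pow, norm_norm]
      gcongr
    · filter_upwards [hlim] with τ hτ
      simpa using hτ.norm.pow 2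
  rw [integral_zero] at h1
  have h2 : ∀ i, ∫ τ, ‖G i τ‖ ^ 2 = ‖g i‖ ^ 2 := fun i => by
    rw [norm_sq_eq_integral]
    refine integral_congr_ae ?_
    filter_upwards [hgG i] with τ hτ
    rw [hτ]
  simp only [h2] at h1
  rw [tendsto_zero_iff_norm_tendsto_zero]
  have h3 := h1.sqrt
  simpa [Real.sqrt_sq] using h3

/-- The function `τ ↦ f τ • y`. -/
def smulVec (f : L2R) (y : F) : Lp F 2 (volume : Measure ℝ) :=
  (ContinuousLinearMap.toSpanSingleton ℂ y).compLp f

theorem coeFn_smulVec (f : L2R) (y : F) : smulVec f y =ᵐ[volume] fun τ => f τ • y :=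
  (ContinuousLinearMap.toSpanSingleton ℂ y).coeFn_compLp f

/-- The bilinear map `(f, y) ↦ (τ ↦ f τ • y)`. -/
def smulVecₗ (F : Type*) [NormedAddCommGroup F] [InnerProductSpace ℂ F] :
    L2R →ₗ[ℂ] F →ₗ[ℂ] Lp F 2 (volume : Measure ℝ) :=
  LinearMap.mk₂ ℂ smulVec
    (fun f g y => by
      refine Lp.ext ?_
      filter_upwards [coeFn_smulVec (f + g) y, coeFn_smulVec f y, coeFn_smulVec g y,
        Lp.coeFn_add (smulVec f y) (smulVec g y), Lp.coeFn_add f g] with τ h1 h2 h3 h4 h5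
      rw [h1, h4, Pi.add_apply, h2, h3, h5, Pi.add_apply, add_smul])
    (fun a f y => by
      refine Lp.ext ?_
      filter_upwards [coeFn_smulVec (a • f) y, coeFn_smulVec f y,
        Lp.coeFn_smul a (smulVec f y), Lp.coeFn_smul a f] with τ h1 h2 h3 h4
      rw [h1, h3, Pi.smul_apply, h2, h4, Pi.smul_apply, smul_assoc])
    (fun f y z => by
      refine Lp.ext ?_
      filter_upwards [coeFn_smulVec f (y + z), coeFn_smulVec f y, coeFn_smulVec f z,
        Lp.coeFn_add (smulVec f y) (smulVec f z)] with τ h1 h2 h3 h4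
      rw [h1, h4, Pi.add_apply, h2, h3, smul_add])
    (fun a f y => by
      refine Lp.ext ?_
      filter_upwards [coeFn_smulVec f (a • y), coeFn_smulVec f y,
        Lp.coeFn_smul a (smulVec f y)] with τ h1 h2 h3
      rw [h1, h3, Pi.smul_apply, h2, smul_comm])

theorem inner_smulVec (f g : L2R) (y z : F) :
    inner ℂ (smulVec f y) (smulVec g z) = inner ℂ f g * inner ℂ y z := by
  rw [L2.inner_def, L2.inner_def, ← integral_mul_const]
  refine integral_congr_ae ?_
  filter_upwards [coeFn_smulVec f y, coeFn_smulVec g z] with τ h1 h2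
  rw [h1, h2, inner_smul_left, inner_smul_right, RCLike.inner_apply]
  ring

/-- An indicator function with value `y` is the scalar indicator times `y`, and simple functions are
dense. -/
theorem span_smulVec_topologicalClosure :
    (Submodule.span ℂ {z : Lp F 2 (volume : Measure ℝ) | ∃ x y, smulVecₗ F x y = z}
      ).topologicalClosure = ⊤ := by
  rw [eq_top_iff]
  rintro f -
  induction f using Lp.induction (by norm_num : (2 : ENNReal) ≠ ⊤) with
  | @indicatorConst y s hs hμs =>
    refine Submodule.le_topologicalClosure _ (Submodule.subset_span
      ⟨indicatorConstLp 2 hs hμs.ne 1, y, ?_⟩)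
    rw [Lp.simpleFunc.coe_indicatorConst]
    refine Lp.ext ?_
    filter_upwards [coeFn_smulVec (indicatorConstLp 2 hs hμs.ne 1) y,
      indicatorConstLp_coeFn (p := 2) (hs := hs) (hμs := hμs.ne) (c := (1 : ℂ)),
      indicatorConstLp_coeFn (p := 2) (hs := hs) (hμs := hμs.ne) (c := y)] with τ h1 h2 h3
    change (smulVec _ y) τ = _
    rw [h1, h2, h3]
    by_cases hτ : τ ∈ s
    · rw [Set.indicator_of_mem hτ, Set.indicator_of_mem hτ, one_smul]
    · rw [Set.indicator_of_notMem hτ, Set.indicator_of_notMem hτ, zero_smul]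
  | add hf hg _ h1 h2 => exact add_mem h1 h2
  | isClosed => exact Submodule.isClosed_topologicalClosure _

theorem exists_vectorReading [CompleteSpace F] {Hc : Type*} [NormedAddCommGroup Hc]
    [InnerProductSpace ℂ Hc] (c : IdealClock Hc) :
    ∃ Φ : HilbertTensor Hc F ≃ₗᵢ[ℂ] Lp F 2 (volume : Measure ℝ),
      ∀ x y, Φ (prodVec x y) = smulVec (c.reading x) y := by
  refine exists_tensorEquiv ((smulVecₗ F).comp c.reading.toLinearEquiv.toLinearMap)
    (fun x x' y y' => ?_) ?_
  · exact (inner_smulVec _ _ _ _).trans (congrArg (· * _) (c.reading.inner_map_map x x'))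
  · rw [← span_smulVec_topologicalClosure]
    congr 2
    ext z
    constructor
    · rintro ⟨x, y, rfl⟩
      exact ⟨c.reading x, y, rfl⟩
    · rintro ⟨f, y, rfl⟩
      refine ⟨c.reading.symm f, y, ?_⟩
      change smulVecₗ F (c.reading (c.reading.symm f)) y = _
      rw [LinearIsometryEquiv.apply_symm_apply]

end VectorValued

/-! ### The fibrewise group `u ↦ (τ ↦ V (t τ) (u τ))` -/

section Fiberwise

variable {F : Type*} [NormedAddCommGroup F] [InnerProductSpace ℂ F]
  {A : F →ₗ.[ℂ] F} {V : ℝ → F ≃ₗᵢ[ℂ] F}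

/-- Measurability comes from the joint continuity of `(s, x) ↦ V s x`, since the group parameter
itself varies with `τ`. -/
theorem memLp_fiberwise (hV : IsUnitaryGroupOf A V) (t : ℝ) (f : Lp F 2 (volume : Measure ℝ)) :
    MemLp (fun τ => V (t * τ) (f τ)) 2 volume := by
  refine (Lp.memLp f).congr_norm ?_ (Filter.Eventually.of_forall fun τ => ?_)
  · have hm : AEStronglyMeasurable (fun τ : ℝ => (t * τ, f τ)) volume :=
      (continuous_const.mul continuous_id).aestronglyMeasurable.prodMk (Lp.aestronglyMeasurable f)
    exact hV.continuous_uncurry.comp_aestronglyMeasurable hm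
  · rw [LinearIsometryEquiv.norm_map]

/-- The operator `f ↦ (τ ↦ V (t τ) (f τ))` on `L²(ℝ; F)`. -/
def fiberwiseFun (hV : IsUnitaryGroupOf A V) (t : ℝ) (f : Lp F 2 (volume : Measure ℝ)) :
    Lp F 2 (volume : Measure ℝ) := (memLp_fiberwise hV t f).toLp

theorem coeFn_fiberwiseFun (hV : IsUnitaryGroupOf A V) (t : ℝ)
    (f : Lp F 2 (volume : Measure ℝ)) :
    fiberwiseFun hV t f =ᵐ[volume] fun τ => V (t * τ) (f τ) := MemLp.coeFn_toLp _

theorem fiberwiseFun_add (hV : IsUnitaryGroupOf A V) (s t : ℝ)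
    (f : Lp F 2 (volume : Measure ℝ)) :
    fiberwiseFun hV (s + t) f = fiberwiseFun hV s (fiberwiseFun hV t f) := by
  refine Lp.ext ?_
  filter_upwards [coeFn_fiberwiseFun hV (s + t) f, coeFn_fiberwiseFun hV t f,
    coeFn_fiberwiseFun hV s (fiberwiseFun hV t f)] with τ h1 h2 h3
  rw [h1, h3, h2, add_mul, hV.add_apply]

theorem fiberwiseFun_zero (hV : IsUnitaryGroupOf A V) (f : Lp F 2 (volume : Measure ℝ)) :
    fiberwiseFun hV 0 f = f := by
  refine Lp.ext ?_
  filter_upwards [coeFn_fiberwiseFun hV 0 f] with τ h1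
  rw [h1, zero_mul, hV.zero_apply]

/-- The unitary operator `f ↦ (τ ↦ V (t τ) (f τ))` on `L²(ℝ; F)`. -/
def fiberwise (hV : IsUnitaryGroupOf A V) (t : ℝ) :
    Lp F 2 (volume : Measure ℝ) ≃ₗᵢ[ℂ] Lp F 2 (volume : Measure ℝ) where
  toFun := fiberwiseFun hV t
  invFun := fiberwiseFun hV (-t)
  left_inv f := by rw [← fiberwiseFun_add, neg_add_cancel, fiberwiseFun_zero]
  right_inv f := by rw [← fiberwiseFun_add, add_neg_cancel, fiberwiseFun_zero]
  map_add' f g := by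
    refine Lp.ext ?_
    filter_upwards [coeFn_fiberwiseFun hV t (f + g), coeFn_fiberwiseFun hV t f,
      coeFn_fiberwiseFun hV t g, Lp.coeFn_add f g,
      Lp.coeFn_add (fiberwiseFun hV t f) (fiberwiseFun hV t g)] with τ h1 h2 h3 h4 h5
    rw [h1, h5, Pi.add_apply, h2, h3, h4, Pi.add_apply, map_add]
  map_smul' a f := by
    refine Lp.ext ?_
    filter_upwards [coeFn_fiberwiseFun hV t (a • f), coeFn_fiberwiseFun hV t f,
      Lp.coeFn_smul a f, Lp.coeFn_smul a (fiberwiseFun hV t f)] with τ h1 h2 h3 h4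
    rw [h1, RingHom.id_apply, h4, Pi.smul_apply, h2, h3, Pi.smul_apply, map_smul]
  norm_map' f := by
    rw [← sq_eq_sq₀ (norm_nonneg _) (norm_nonneg _), norm_sq_eq_integral, norm_sq_eq_integral]
    refine integral_congr_ae ?_
    filter_upwards [coeFn_fiberwiseFun hV t f] with τ h1
    change ‖fiberwiseFun hV t f τ‖ ^ 2 = _
    rw [h1, LinearIsometryEquiv.norm_map]

theorem coeFn_fiberwise (hV : IsUnitaryGroupOf A V) (t : ℝ) (f : Lp F 2 (volume : Measure ℝ)) :
    fiberwise hV t f =ᵐ[volume] fun τ => V (t * τ) (f τ) := coeFn_fiberwiseFun hV t f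

theorem fiberwise_zero (hV : IsUnitaryGroupOf A V) :
    fiberwise hV 0 = LinearIsometryEquiv.refl ℂ _ :=
  LinearIsometryEquiv.ext (fiberwiseFun_zero hV)

theorem fiberwise_add (hV : IsUnitaryGroupOf A V) (s t : ℝ) :
    fiberwise hV (s + t) = (fiberwise hV t).trans (fiberwise hV s) :=
  LinearIsometryEquiv.ext (fiberwiseFun_add hV s t)

theorem continuous_fiberwise (hV : IsUnitaryGroupOf A V) (f : Lp F 2 (volume : Measure ℝ)) :
    Continuous fun t => fiberwise hV t f := by
  rw [continuous_iff_continuousAt]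
  intro t
  rw [ContinuousAt, tendsto_sub_nhds_zero_iff.symm]
  refine tendsto_zero_of_dominated (G := fun s τ => V (s * τ) (f τ) - V (t * τ) (f τ))
    (b := fun τ => 2 * ‖f τ‖) (fun s => ?_) ?_ (fun s => ?_) ?_
  · filter_upwards [coeFn_fiberwise hV s f, coeFn_fiberwise hV t f,
      Lp.coeFn_sub (fiberwise hV s f) (fiberwise hV t f)] with τ h1 h2 h3
    rw [h3, Pi.sub_apply, h1, h2]
  · simp only [mul_pow]
    exact ((memLp_two_iff_integrable_sq_norm (Lp.aestronglyMeasurable f)).1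
      (Lp.memLp f)).const_mul _
  · refine Filter.Eventually.of_forall fun τ => (norm_sub_le _ _).trans ?_
    rw [LinearIsometryEquiv.norm_map, LinearIsometryEquiv.norm_map, two_mul]
  · refine Filter.Eventually.of_forall fun τ => ?_
    have hc : Continuous fun s : ℝ => V (s * τ) (f τ) - V (t * τ) (f τ) :=
      ((hV.continuous (f τ)).comp (continuous_id.mul continuous_const)).sub continuous_const
    simpa using hc.tendsto t

/-- The fibrewise difference quotient is at most `|τ| ‖A y‖`, and `τ f(τ) = g(τ)` is square
integrable exactly because `f` is in the domain of multiplication by `τ`. Dominated convergence then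
turns the pointwise derivative into one in `L²`. -/
theorem hasDerivAt_fiberwise_smulVec (hV : IsUnitaryGroupOf A V) {f g : L2R}
    (hfg : (f, g) ∈ mulTau.graph) {p : F × F} (hp : p ∈ A.graph) :
    HasDerivAt (fun t : ℝ => fiberwise hV t (smulVec f p.1)) (Complex.I • smulVec g p.2) 0 := by
  rw [mem_graph_mulTau] at hfg
  rw [hasDerivAt_iff_tendsto_slope_zero, tendsto_sub_nhds_zero_iff.symm]
  refine tendsto_zero_of_dominated
    (G := fun t τ => f τ • (t⁻¹ • (V (t * τ) p.1 - p.1) - τ • Complex.I • p.2))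
    (b := fun τ => 2 * ‖p.2‖ * ‖g τ‖) (fun t => ?_) ?_ (fun t => ?_) ?_
  · rw [zero_add, fiberwise_zero, LinearIsometryEquiv.coe_refl, id_eq]
    filter_upwards [coeFn_fiberwise hV t (smulVec f p.1), coeFn_smulVec f p.1,
      coeFn_smulVec g p.2, hfg,
      Lp.coeFn_sub (t⁻¹ • (fiberwise hV t (smulVec f p.1) - smulVec f p.1))
        (Complex.I • smulVec g p.2),
      Lp.coeFn_smul t⁻¹ (fiberwise hV t (smulVec f p.1) - smulVec f p.1),
      Lp.coeFn_sub (fiberwise hV t (smulVec f p.1)) (smulVec f p.1),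
      Lp.coeFn_smul Complex.I (smulVec g p.2)] with τ h1 h2 h3 h4 h5 h6 h7 h8
    rw [h5, Pi.sub_apply, h6, Pi.smul_apply, h7, Pi.sub_apply, h8, Pi.smul_apply, h1, h2, h3, h4,
      map_smul, ← smul_sub, smul_comm t⁻¹ (f τ), smul_sub (f τ), ← Complex.coe_smul τ]
    congr 1
    simp only [smul_smul]
    congr 1
    ring
  · simp only [mul_pow]
    exact ((memLp_two_iff_integrable_sq_norm (Lp.aestronglyMeasurable g)).1
      (Lp.memLp g)).const_mul _
  · filter_upwards [hfg] with τ h4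
    have e1 : ‖t⁻¹ • (V (t * τ) p.1 - p.1)‖ ≤ |τ| * ‖p.2‖ := by
      rw [norm_smul, norm_inv, Real.norm_eq_abs]
      have h := hV.norm_sub_le hp (t * τ)
      rw [abs_mul, mul_assoc] at h
      -- The bound is required for every `t`; at `t = 0` the quotient is `0` because `0⁻¹ = 0`.
      rcases eq_or_ne t 0 with rfl | ht
      · rw [abs_zero, inv_zero, zero_mul]
        positivity
      · rwa [inv_mul_le_iff₀ (abs_pos.2 ht)]
    have e2 : ‖τ • Complex.I • p.2‖ = |τ| * ‖p.2‖ := by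
      rw [norm_smul, norm_smul, Complex.norm_I, one_mul, Real.norm_eq_abs]
    have e3 := norm_sub_le (t⁻¹ • (V (t * τ) p.1 - p.1)) (τ • Complex.I • p.2)
    rw [norm_smul, h4, norm_mul, Complex.norm_real, Real.norm_eq_abs]
    nlinarith [norm_nonneg (f τ)]
  · refine Filter.Eventually.of_forall fun τ => ?_
    have h1 : HasDerivAt (fun t : ℝ => V (t * τ) p.1) (τ • Complex.I • p.2) 0 := by
      have h2 := hV.hasDerivAt hp (0 * τ)
      have h3 := h2.scomp (0 : ℝ) ((hasDerivAt_id (0 : ℝ)).mul_const τ)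
      rw [zero_mul, hV.zero_apply, one_mul] at h3
      exact h3
    rw [hasDerivAt_iff_tendsto_slope_zero] at h1
    have h4 := (h1.sub_const (τ • Complex.I • p.2)).const_smul (f τ)
    simpa [hV.zero_apply] using h4

end Fiberwise

/-! ### The unitary group generated by `T ⊗ A` and its action on the two Hamiltonians -/

section Interaction

variable {Hc F : Type*} [NormedAddCommGroup Hc] [InnerProductSpace ℂ Hc]
  [NormedAddCommGroup F] [InnerProductSpace ℂ F]
  {c : IdealClock Hc} {Φ : HilbertTensor Hc F ≃ₗᵢ[ℂ] Lp F 2 (volume : Measure ℝ)}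
  {A : F →ₗ.[ℂ] F} {V : ℝ → F ≃ₗᵢ[ℂ] F}

theorem inner_prodVec_eq_integral (hΦ : ∀ x y, Φ (prodVec x y) = smulVec (c.reading x) y)
    (x : Hc) (y : F) (u : HilbertTensor Hc F) : inner ℂ (prodVec x y) u =
      ∫ τ, (starRingEnd ℂ) (c.reading x τ) * inner ℂ y (Φ u τ) := by
  rw [← Φ.inner_map_map, hΦ, L2.inner_def]
  refine integral_congr_ae ?_
  filter_upwards [coeFn_smulVec (c.reading x) y] with τ h
  rw [h, inner_smul_left]

theorem inner_prodVec_testState (hΦ : ∀ x y, Φ (prodVec x y) = smulVec (c.reading x) y)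
    {φ : ℝ → ℝ} (h : ContDiff ℝ ∞ φ) (hs : HasCompactSupport φ) (y : F)
    (u : HilbertTensor Hc F) : inner ℂ (prodVec (c.testState h hs) y) u =
      ∫ τ, φ τ • inner ℂ y (Φ u τ) := by
  rw [inner_prodVec_eq_integral hΦ]
  refine integral_congr_ae ?_
  rw [IdealClock.testState, LinearIsometryEquiv.apply_symm_apply]
  filter_upwards [coeFn_testVec h hs] with τ h1
  rw [h1, Complex.conj_ofReal, Complex.real_smul]

/-- An element of the adjoint of `T ⊗ A` satisfies the eigenvalue-wise relation
`v τ = A (τ u τ)`. -/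
theorem ae_mem_graph_of_mem_adjoint [CompleteSpace F] [TopologicalSpace.SeparableSpace F]
    (hΦ : ∀ x y, Φ (prodVec x y) = smulVec (c.reading x) y) (hA : IsSelfAdjoint A)
    {u v : HilbertTensor Hc F} (h : (u, v) ∈ (tensorGraph c.timeOp A).adjoint) :
    ∀ᵐ τ : ℝ, ((τ : ℂ) • Φ u τ, Φ v τ) ∈ A.graph := by
  have h1 : ∀ q ∈ A.graph, ∀ᵐ τ : ℝ, inner ℂ q.2 ((τ : ℂ) • Φ u τ) = inner ℂ q.1 (Φ v τ) := by
    intro q hq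
    have hu : LocallyIntegrable (fun τ : ℝ => inner ℂ q.2 ((τ : ℂ) • Φ u τ)) volume := by
      have h2 : LocallyIntegrable (fun τ => inner ℂ q.2 (Φ u τ)) volume :=
        ((Lp.memLp (Φ u)).const_inner q.2).locallyIntegrable (by norm_num)
      have h3 := h2.continuous_smul (g := fun τ : ℝ => (τ : ℂ)) Complex.continuous_ofReal
      simpa only [inner_smul_right, smul_eq_mul] using h3
    have hv : LocallyIntegrable (fun τ => inner ℂ q.1 (Φ v τ)) volume :=
      ((Lp.memLp (Φ v)).const_inner q.1).locallyIntegrable (by norm_num)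
    refine ae_eq_of_integral_contDiff_smul_eq hu hv fun φ hφ hs => ?_
    obtain ⟨y, hy1, hy2⟩ := LinearPMap.mem_graph_iff _ |>.1 hq
    obtain ⟨x, hx1, hx2⟩ := LinearPMap.mem_graph_iff _ |>.1 (c.testState_mem_graph_timeOp hφ hs)
    have h3 := mem_adjoint.1 h (prodVec (x : Hc) (y : F), prodVec (c.timeOp x) (A y))
      (Submodule.subset_span ⟨x, y, rfl⟩)
    simp only [hx1, hx2, hy1, hy2] at h3
    rw [inner_prodVec_testState hΦ, inner_prodVec_testState hΦ] at h3
    rw [← h3]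
    refine integral_congr_ae (Filter.Eventually.of_forall fun τ => ?_)
    simp only [inner_smul_right, Complex.real_smul, Complex.ofReal_mul]
    ring
  -- For each single element of the graph of `A` the relation holds off a null set depending on that
  -- element. Separability reduces to countably many elements, so that one null set serves for all.
  obtain ⟨s, hs, hds⟩ := TopologicalSpace.exists_countable_dense A.graph
  have h2 : ∀ᵐ τ : ℝ, ∀ q ∈ s, inner ℂ (q : F × F).2 ((τ : ℂ) • Φ u τ) =
      inner ℂ (q : F × F).1 (Φ v τ) := (ae_ball_iff hs).2 fun q _ => h1 q q.2
  filter_upwards [h2] with τ hτ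
  rw [← graph_adjoint_of_isSelfAdjoint hA]
  refine mem_adjoint.2 fun q hq => ?_
  have hc : IsClosed {q : A.graph | inner ℂ (q : F × F).2 ((τ : ℂ) • Φ u τ) =
      inner ℂ (q : F × F).1 (Φ v τ)} :=
    isClosed_eq ((continuous_snd.comp continuous_subtype_val).inner continuous_const)
      ((continuous_fst.comp continuous_subtype_val).inner continuous_const)
  exact closure_minimal hτ hc (hds ⟨q, hq⟩)

/-- For a deficiency pair, almost every fibre satisfies `A (τ u) = v` and `A (τ v) = -u`. Symmetry
of `A` gives `-τ ‖u‖² = τ ‖v‖²`, so both vanish for `τ ≠ 0`. -/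
theorem tensorOp_timeOp_graph [CompleteSpace F] [TopologicalSpace.SeparableSpace F]
    (hΦ : ∀ x y, Φ (prodVec x y) = smulVec (c.reading x) y) (hA : IsSelfAdjoint A) :
    (tensorOp c.timeOp A).graph = (tensorGraph c.timeOp A).adjoint := by
  have hA' : A.IsFormalAdjoint A :=
    isFormalAdjoint_of_graph_le (graph_adjoint_of_isSelfAdjoint hA).ge
  refine tensorOp_graph_eq_adjoint c.dense_domain_timeOp hA.dense_domain
    c.timeOp_isFormalAdjoint hA' le_rfl (topologicalClosure_eq_adjoint
      (tensorGraph_le_adjoint c.timeOp_isFormalAdjoint hA') fun u v h1 h2 => ?_)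
  have hae : ∀ᵐ τ : ℝ, Φ u τ = 0 ∧ Φ v τ = 0 := by
    have h0 : ∀ᵐ τ : ℝ, τ ≠ 0 := by simp [ae_iff]
    filter_upwards [ae_mem_graph_of_mem_adjoint hΦ hA h1,
      ae_mem_graph_of_mem_adjoint hΦ hA h2, Lp.coeFn_neg (Φ u), h0] with τ e1 e2 e3 e4
    rw [map_neg, e3, Pi.neg_apply] at e2
    have e5 := inner_graph_comm hA e1 e2
    simp only [inner_smul_left, inner_smul_right, Complex.conj_ofReal] at e5
    exact eq_zero_of_inner_graph (mul_left_cancel₀ (by exact_mod_cast e4) e5)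
  constructor
  · rw [← map_eq_zero_iff Φ Φ.injective, Lp.eq_zero_iff_ae_eq_zero]
    exact hae.mono fun τ h => h.1
  · rw [← map_eq_zero_iff Φ Φ.injective, Lp.eq_zero_iff_ae_eq_zero]
    exact hae.mono fun τ h => h.2

/-- The unitary group on the Hilbert tensor product which under the identification `Φ` with
`L²(ℝ; F)` acts as `u ↦ (τ ↦ V (t τ) (u τ))`. -/
def interaction (Φ : HilbertTensor Hc F ≃ₗᵢ[ℂ] Lp F 2 (volume : Measure ℝ))
    (hV : IsUnitaryGroupOf A V) (t : ℝ) : HilbertTensor Hc F ≃ₗᵢ[ℂ] HilbertTensor Hc F :=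
  (Φ.trans (fiberwise hV t)).trans Φ.symm

theorem map_interaction (hV : IsUnitaryGroupOf A V) (t : ℝ) (u : HilbertTensor Hc F) :
    Φ (interaction Φ hV t u) = fiberwise hV t (Φ u) := Φ.apply_symm_apply _

/-- On product vectors the derivative is the fibrewise computation, and it extends to the closure of
their span. Self-adjointness of `T ⊗ A` then excludes a larger generator. -/
theorem isUnitaryGroupOf_interaction [CompleteSpace F] [TopologicalSpace.SeparableSpace F]
    (hΦ : ∀ x y, Φ (prodVec x y) = smulVec (c.reading x) y) (hA : IsSelfAdjoint A)
    (hV : IsUnitaryGroupOf A V) :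
    IsUnitaryGroupOf (tensorOp c.timeOp A) (interaction Φ hV) := by
  have h0 : interaction Φ hV 0 = LinearIsometryEquiv.refl ℂ _ := by
    ext u
    apply Φ.injective
    rw [map_interaction, fiberwise_zero]
    rfl
  have hadd : ∀ s t : ℝ, interaction Φ hV (s + t) =
      (interaction Φ hV t).trans (interaction Φ hV s) := by
    intro s t
    ext u
    apply Φ.injective
    rw [LinearIsometryEquiv.trans_apply, map_interaction, map_interaction, map_interaction,
      fiberwise_add]
    rfl
  have hcont : ∀ u, Continuous fun t => interaction Φ hV t u := fun u =>
    Φ.symm.continuous.comp (continuous_fiberwise hV (Φ u))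
  have hgr := tensorOp_timeOp_graph hΦ hA
  have hA' : A.IsFormalAdjoint A :=
    isFormalAdjoint_of_graph_le (graph_adjoint_of_isSelfAdjoint hA).ge
  have hcl := tensorOp_graph c.dense_domain_timeOp hA.dense_domain c.timeOp_isFormalAdjoint hA'
  refine isUnitaryGroupOf_of_hasDerivAt ?_ h0 hadd hcont fun p hp => ?_
  · rw [hcl, adjoint_topologicalClosure, ← hgr, hcl]
  · rw [hcl] at hp
    refine hasDerivAt_zero_of_mem_topologicalClosure_span h0 hadd hcont ?_ hp
    rintro _ ⟨x, y, rfl⟩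
    have hx : (c.reading x, c.reading (c.timeOp x)) ∈ mulTau.graph :=
      mem_graph_conj.1 (c.timeOp.mem_graph x)
    have h1 := hasDerivAt_fiberwise_smulVec hV hx (A.mem_graph y)
    have h2 := (Φ.symm.toContinuousLinearEquiv.toContinuousLinearMap.restrictScalars ℝ
      ).hasFDerivAt.comp_hasDerivAt (0 : ℝ) h1
    simp only [← hΦ] at h2
    refine h2.congr_deriv ?_
    change Φ.symm (Complex.I • Φ _) = _
    rw [map_smul, LinearIsometryEquiv.symm_apply_apply]

theorem coeFn_interaction_prodVec (hΦ : ∀ x y, Φ (prodVec x y) = smulVec (c.reading x) y)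
    (hV : IsUnitaryGroupOf A V) (t : ℝ) (x : Hc) (y : F) :
    Φ (interaction Φ hV t (prodVec x y)) =ᵐ[volume] fun τ => c.reading x τ • V (t * τ) y := by
  rw [map_interaction, hΦ]
  filter_upwards [coeFn_fiberwise hV t (smulVec (c.reading x) y),
    coeFn_smulVec (c.reading x) y] with τ h1 h2
  rw [h1, h2, map_smul]

theorem coeFn_interaction_testState (hΦ : ∀ x y, Φ (prodVec x y) = smulVec (c.reading x) y)
    (hV : IsUnitaryGroupOf A V) (t : ℝ) {φ : ℝ → ℝ} (h : ContDiff ℝ ∞ φ)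
    (hs : HasCompactSupport φ) (y : F) :
    Φ (interaction Φ hV t (prodVec (c.testState h hs) y)) =ᵐ[volume]
      fun τ => φ τ • V (t * τ) y := by
  filter_upwards [coeFn_interaction_prodVec hΦ hV t (c.testState h hs) y,
    coeFn_testVec h hs] with τ h1 h2
  rw [h1, IdealClock.testState, LinearIsometryEquiv.apply_symm_apply, h2, Complex.coe_smul]

/-- In each fibre `V (t τ)` preserves the graph of `A`, so the symmetry of `A` can be used under the
integral. -/
theorem interaction_mem_graph_idOp_tensorOp [CompleteSpace F]
    (hΦ : ∀ x y, Φ (prodVec x y) = smulVec (c.reading x) y) (hA : IsSelfAdjoint A)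
    (hV : IsUnitaryGroupOf A V) (t : ℝ) (x : Hc) {p : F × F} (hp : p ∈ A.graph) :
    (interaction Φ hV t (prodVec x p.1), interaction Φ hV t (prodVec x p.2)) ∈
      (tensorOp (idOp Hc) A).graph := by
  rw [tensorOp_idOp_graph hA]
  refine mem_rightGraph_adjoint.2 fun x' q hq => ?_
  simp only
  rw [inner_prodVec_eq_integral hΦ, inner_prodVec_eq_integral hΦ]
  refine integral_congr_ae ?_
  filter_upwards [coeFn_interaction_prodVec hΦ hV t x p.1,
    coeFn_interaction_prodVec hΦ hV t x p.2] with τ h1 h2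
  rw [h1, h2, inner_smul_right, inner_smul_right,
    inner_graph_comm hA (hV.map_mem_graph hp (t * τ)) hq]

theorem mem_testGraph_adjoint {ħ : ℝ} {p : Hc × Hc} : p ∈ (c.testGraph ħ).adjoint ↔
    ∀ (φ : ℝ → ℝ) (h : ContDiff ℝ ∞ φ) (hs : HasCompactSupport φ),
      inner ℂ (-(Complex.I * ħ) • c.testState (contDiff_deriv h) hs.deriv) p.1 =
        inner ℂ (c.testState h hs) p.2 := by
  rw [IdealClock.testGraph, testGraph, Submodule.map_span, mem_adjoint_span]
  constructor
  · intro H φ h hs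
    have h1 := H _ ⟨_, ⟨φ, h, hs, rfl⟩, rfl⟩
    change inner ℂ (c.reading.symm _) p.1 = _ at h1
    rw [map_smul] at h1
    exact h1
  · rintro H _ ⟨_, ⟨φ, h, hs, rfl⟩, rfl⟩
    have h1 := H φ h hs
    change inner ℂ (c.reading.symm _) p.1 = _
    rw [map_smul]
    exact h1

theorem mem_leftGraph_testGraph_adjoint [CompleteSpace Hc] {ħ : ℝ} {D : Submodule ℂ F}
    {p : HilbertTensor Hc F × HilbertTensor Hc F}
    (H : ∀ (φ : ℝ → ℝ) (h : ContDiff ℝ ∞ φ) (hs : HasCompactSupport φ), ∀ y ∈ D,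
      Complex.I * ħ * inner ℂ (prodVec (c.testState (contDiff_deriv h) hs.deriv) y) p.1 =
        inner ℂ (prodVec (c.testState h hs) y) p.2) :
    p ∈ (leftGraph (c.testGraph ħ) D).adjoint := by
  refine mem_leftGraph_adjoint.2 fun q hq y hy => ?_
  have h1 : (ContinuousLinearMap.adjoint (prodVecLeft (E := Hc) y) p.1,
      ContinuousLinearMap.adjoint (prodVecLeft (E := Hc) y) p.2) ∈ (c.testGraph ħ).adjoint := by
    refine mem_testGraph_adjoint.2 fun φ h hs => ?_
    simp only [ContinuousLinearMap.adjoint_inner_right, map_smul, inner_smul_left]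
    have h2 := H φ h hs y hy
    simpa [prodVecLeft_apply] using h2
  have h2 := mem_adjoint.1 h1 q hq
  simpa only [ContinuousLinearMap.adjoint_inner_right, prodVecLeft_apply] using h2

/-- This is the product rule for `φ(τ) V (-τ/ħ) y`, in weak form: paired with `ψ ⊗ y'` it becomes a
scalar integration by parts. The factor `-1/ħ` from the chain rule cancels the `ħ` of `-iħ d/dτ` and
leaves `-A`. -/
theorem interaction_mem_graph_hamiltonian [CompleteSpace Hc] [CompleteSpace F]
    (hΦ : ∀ x y, Φ (prodVec x y) = smulVec (c.reading x) y) (hA : IsSelfAdjoint A)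
    (hV : IsUnitaryGroupOf A V) {ħ : ℝ} (hħ : ħ ≠ 0) {φ : ℝ → ℝ} (h : ContDiff ℝ ∞ φ)
    (hs : HasCompactSupport φ) {p : F × F} (hp : p ∈ A.graph) :
    (interaction Φ hV (-ħ⁻¹) (prodVec (c.testState h hs) p.1),
      -(Complex.I * ħ) • interaction Φ hV (-ħ⁻¹)
        (prodVec (c.testState (contDiff_deriv h) hs.deriv) p.1) -
      interaction Φ hV (-ħ⁻¹) (prodVec (c.testState h hs) p.2)) ∈
      (tensorOp (c.hamiltonian ħ) (idOp F)).graph := by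
  rw [c.tensorOp_hamiltonian_idOp_graph hħ hA.dense_domain]
  refine mem_leftGraph_testGraph_adjoint fun ψ hψ hψs y _ => ?_
  simp only [inner_sub_right, inner_smul_right]
  have key : ∀ {χ θ : ℝ → ℝ} (hχ : ContDiff ℝ ∞ χ) (hχs : HasCompactSupport χ)
      (hθ : ContDiff ℝ ∞ θ) (hθs : HasCompactSupport θ) (z : F),
      inner ℂ (prodVec (c.testState hχ hχs) y)
        (interaction Φ hV (-ħ⁻¹) (prodVec (c.testState hθ hθs) z)) =
      ∫ τ, χ τ • θ τ • inner ℂ y (V (-ħ⁻¹ * τ) z) := by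
    intro χ θ hχ hχs hθ hθs z
    rw [inner_prodVec_testState hΦ]
    refine integral_congr_ae ?_
    filter_upwards [coeFn_interaction_testState hΦ hV (-ħ⁻¹) hθ hθs z] with τ e
    rw [e, ← Complex.coe_smul (θ τ), inner_smul_right, Complex.real_smul (x := θ τ)]
  rw [key, key, key]
  have hc : ∀ z, Continuous fun τ : ℝ => inner ℂ y (V (-ħ⁻¹ * τ) z) := fun z =>
    continuous_const.inner ((hV.continuous z).comp (continuous_const.mul continuous_id))
  have hd : ∀ τ : ℝ, HasDerivAt (fun τ : ℝ => φ τ • inner ℂ y (V (-ħ⁻¹ * τ) p.1))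
      (φ τ • ((-ħ⁻¹ : ℝ) • (Complex.I * inner ℂ y (V (-ħ⁻¹ * τ) p.2))) +
        deriv φ τ • inner ℂ y (V (-ħ⁻¹ * τ) p.1)) τ := by
    intro τ
    have h1 : HasDerivAt (fun τ : ℝ => V (-ħ⁻¹ * τ) p.1)
        ((-ħ⁻¹ : ℝ) • V (-ħ⁻¹ * τ) (Complex.I • p.2)) τ := by
      have h2 := (hV.hasDerivAt hp (-ħ⁻¹ * τ)).scomp τ ((hasDerivAt_id τ).const_mul (-ħ⁻¹))
      rw [mul_one] at h2
      exact h2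
    have h3 : HasDerivAt (fun τ : ℝ => inner ℂ y (V (-ħ⁻¹ * τ) p.1))
        ((-ħ⁻¹ : ℝ) • (Complex.I * inner ℂ y (V (-ħ⁻¹ * τ) p.2))) τ := by
      have h4 := (hasDerivAt_const τ y).inner ℂ h1
      rw [inner_zero_left, add_zero, map_smul, ← Complex.coe_smul, inner_smul_right,
        inner_smul_right] at h4
      rw [Complex.real_smul]
      exact h4
    exact ((h.differentiable (by simp)) τ).hasDerivAt.smul h3
  have hφ' : Continuous (deriv φ) := (contDiff_deriv h).continuous
  have hip := integral_deriv_smul_eq_neg hψ hψs hd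
    ((h.continuous.smul ((continuous_const.mul (hc p.2)).const_smul (-ħ⁻¹ : ℝ))).add
      (hφ'.smul (hc p.1)))
  rw [hip]
  have i1 : Integrable (fun τ => ψ τ • φ τ • inner ℂ y (V (-ħ⁻¹ * τ) p.2)) :=
    (hψ.continuous.smul (h.continuous.smul (hc p.2))).integrable_of_hasCompactSupport
      hψs.smul_right
  have i2 : Integrable (fun τ => ψ τ • deriv φ τ • inner ℂ y (V (-ħ⁻¹ * τ) p.1)) :=
    (hψ.continuous.smul (hφ'.smul (hc p.1))).integrable_of_hasCompactSupport hψs.smul_right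
  have hsplit : ∫ τ, ψ τ • (φ τ • ((-ħ⁻¹ : ℝ) • (Complex.I * inner ℂ y (V (-ħ⁻¹ * τ) p.2))) +
        deriv φ τ • inner ℂ y (V (-ħ⁻¹ * τ) p.1)) =
      (-ħ⁻¹ * Complex.I) * (∫ τ, ψ τ • φ τ • inner ℂ y (V (-ħ⁻¹ * τ) p.2)) +
        ∫ τ, ψ τ • deriv φ τ • inner ℂ y (V (-ħ⁻¹ * τ) p.1) := by
    rw [← integral_const_mul, ← integral_add (i1.const_mul _) i2]
    refine integral_congr_ae (Filter.Eventually.of_forall fun τ => ?_)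
    simp only [Complex.real_smul, Complex.ofReal_neg, Complex.ofReal_inv]
    ring
  rw [hsplit]
  have hħ' : (ħ : ℂ) * ((ħ⁻¹ : ℝ) : ℂ) = 1 := by
    rw [← Complex.ofReal_mul, mul_inv_cancel₀ hħ, Complex.ofReal_one]
  linear_combination (∫ τ, ψ τ • φ τ • inner ℂ y (V (-ħ⁻¹ * τ) p.2)) *
    (Complex.I * Complex.I * hħ' + Complex.I_mul_I)

theorem interaction_symm [CompleteSpace F] [TopologicalSpace.SeparableSpace F]
    (hΦ : ∀ x y, Φ (prodVec x y) = smulVec (c.reading x) y) (hA : IsSelfAdjoint A)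
    (hV : IsUnitaryGroupOf A V) (t : ℝ) (u : HilbertTensor Hc F) :
    (interaction Φ hV t).symm u = interaction Φ hV (-t) u :=
  (isUnitaryGroupOf_interaction hΦ hA hV).symm_apply t u

/-- Testing on `φ ⊗ y` shows that `V (t τ) y = y` for almost every `τ`, hence for all `τ` by
continuity. With `t ≠ 0` the whole group is trivial, and its generator is zero on all of `F`. -/
theorem eq_zero_of_interaction_eq_refl (hΦ : ∀ x y, Φ (prodVec x y) = smulVec (c.reading x) y)
    [CompleteSpace F] (hV : IsUnitaryGroupOf A V) {t : ℝ} (ht : t ≠ 0)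
    (h : ∀ u, interaction Φ hV t u = u) : A = 0 := by
  have h1 : ∀ y s, V s y = y := by
    intro y
    have hc : Continuous fun τ : ℝ => V (t * τ) y - y :=
      ((hV.continuous y).comp (continuous_const.mul continuous_id)).sub continuous_const
    have h2 : ∀ᵐ τ : ℝ, V (t * τ) y - y = 0 := by
      refine ae_eq_zero_of_integral_contDiff_smul_eq_zero hc.locallyIntegrable fun φ hφ hs => ?_
      refine integral_eq_zero_of_ae ?_
      have h3 := coeFn_interaction_testState hΦ hV t hφ hs y
      rw [h, hΦ, IdealClock.testState, LinearIsometryEquiv.apply_symm_apply] at h3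
      filter_upwards [h3, coeFn_smulVec (testVec φ hφ hs) y, coeFn_testVec hφ hs] with τ e1 e2 e3
      rw [e2, e3, Complex.coe_smul] at e1
      rw [smul_sub, ← e1, sub_self, Pi.zero_apply]
    have h3 : (fun τ : ℝ => V (t * τ) y - y) = fun _ => 0 :=
      (Continuous.ae_eq_iff_eq volume hc continuous_const).1 h2
    intro s
    have h4 := congrFun h3 (s / t)
    rw [mul_div_cancel₀ _ ht] at h4
    exact sub_eq_zero.1 h4
  have h2 : ∀ y, (y, 0) ∈ A.graph := by
    intro y
    rw [hV.generator]
    simp only [h1, smul_zero]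
    exact hasDerivAt_const _ _
  have h3 : A.domain = ⊤ := Submodule.eq_top_iff'.2 fun y =>
    LinearPMap.mem_domain_of_mem_graph (h2 y)
  refine LinearPMap.ext h3 fun y hy _ => ?_
  exact A.mem_graph_snd_inj (A.mem_graph ⟨y, hy⟩) (h2 y) rfl

end Interaction

/-! ### Closures of symmetric sums and the removal of the world Hamiltonian -/

section TotalHamiltonian

variable {E F : Type*} [NormedAddCommGroup E] [InnerProductSpace ℂ E]
  [NormedAddCommGroup F] [InnerProductSpace ℂ F]

/-- A symmetric extension of an essentially self-adjoint relation has the same closure. -/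
theorem closure_eq_of_le_graph {T S : E →ₗ.[ℂ] E} {D : Submodule ℂ (E × E)}
    (hT : T.IsFormalAdjoint T) (hD : D ≤ T.graph) (hD' : D.topologicalClosure = D.adjoint)
    (hS : S.graph = D.adjoint) : T.closure = S := by
  have hT' : T.graph ≤ T.graph.adjoint := fun p hp => mem_adjoint.2 fun q hq => by
    obtain ⟨x, hx1, hx2⟩ := LinearPMap.mem_graph_iff _ |>.1 hp
    obtain ⟨y, hy1, hy2⟩ := LinearPMap.mem_graph_iff _ |>.1 hq
    rw [← hx1, ← hx2, ← hy1, ← hy2]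
    exact hT y x
  have h : T.graph.topologicalClosure = S.graph := by
    refine le_antisymm ?_ ?_
    · rw [hS]
      exact Submodule.topologicalClosure_minimal _ (hT'.trans (adjoint_antitone hD))
        (isClosed_adjoint _)
    · rw [hS, ← hD']
      exact Submodule.topologicalClosure_mono hD
  -- `S` itself witnesses closability, its graph being the closure of that of `T`.
  have hc : T.IsClosable := ⟨S, h⟩
  exact LinearPMap.eq_of_eq_graph (hc.graph_closure_eq_closure_graph.symm.trans h)

theorem tensorOp_isFormalAdjoint {A : E →ₗ.[ℂ] E} {B : F →ₗ.[ℂ] F}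
    (hA : Dense (A.domain : Set E)) (hB : Dense (B.domain : Set F))
    (hA' : A.IsFormalAdjoint A) (hB' : B.IsFormalAdjoint B) :
    (tensorOp A B).IsFormalAdjoint (tensorOp A B) := by
  refine isFormalAdjoint_of_graph_le ?_
  rw [tensorOp_graph hA hB hA' hB', adjoint_topologicalClosure]
  exact Submodule.topologicalClosure_minimal _ (tensorGraph_le_adjoint hA' hB')
    (isClosed_adjoint _)

theorem isFormalAdjoint_add {S T : E →ₗ.[ℂ] E} (hS : S.IsFormalAdjoint S)
    (hT : T.IsFormalAdjoint T) : (S + T).IsFormalAdjoint (S + T) := by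
  rintro ⟨x, hx⟩ ⟨y, hy⟩
  have h1 := hS ⟨x, hx.1⟩ ⟨y, hy.1⟩
  have h2 := hT ⟨x, hx.2⟩ ⟨y, hy.2⟩
  change inner ℂ (S ⟨x, hx.1⟩ + T ⟨x, hx.2⟩) y = inner ℂ x (S ⟨y, hy.1⟩ + T ⟨y, hy.2⟩)
  rw [inner_add_left, inner_add_right, h1, h2]

theorem add_mem_graph {S T : E →ₗ.[ℂ] E} {x y z : E} (hS : (x, y) ∈ S.graph)
    (hT : (x, z) ∈ T.graph) : (x, y + z) ∈ (S + T).graph := by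
  obtain ⟨x₁, rfl, rfl⟩ := LinearPMap.mem_graph_iff _ |>.1 hS
  obtain ⟨x₂, h, rfl⟩ := LinearPMap.mem_graph_iff _ |>.1 hT
  obtain ⟨x₂, hx₂⟩ := x₂
  simp only at h
  subst h
  exact (S + T).mem_graph ⟨x₁, x₁.2, hx₂⟩

variable {Hc : Type*} [NormedAddCommGroup Hc] [InnerProductSpace ℂ Hc]
  {c : IdealClock Hc} {Φ : HilbertTensor Hc F ≃ₗᵢ[ℂ] Lp F 2 (volume : Measure ℝ)}
  {A : F →ₗ.[ℂ] F} {V : ℝ → F ≃ₗᵢ[ℂ] F} {ħ : ℝ}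

theorem noninteracting_sum_isFormalAdjoint [CompleteSpace F] (hA : IsSelfAdjoint A)
    (hħ : ħ ≠ 0) : (tensorOp (c.hamiltonian ħ) (idOp F) + tensorOp (idOp Hc) A).IsFormalAdjoint
      (tensorOp (c.hamiltonian ħ) (idOp F) + tensorOp (idOp Hc) A) :=
  isFormalAdjoint_add
    (tensorOp_isFormalAdjoint (c.dense_domain_hamiltonian ħ) dense_domain_idOp
      (c.hamiltonian_isFormalAdjoint hħ) idOp_isFormalAdjoint)
    (tensorOp_isFormalAdjoint dense_domain_idOp hA.dense_domain idOp_isFormalAdjoint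
      (isFormalAdjoint_of_graph_le (graph_adjoint_of_isSelfAdjoint hA).ge))

/-- The algebraic core of the proposition: on `S⁻¹ (φ ⊗ y)` the term `-S⁻¹ (φ ⊗ A y)` from the clock
cancels the contribution of `I ⊗ A`. Taking `y` in the domain of `A` puts the vector in both
domains. -/
theorem leftGraph_map_le_graph [CompleteSpace Hc] [CompleteSpace F]
    [TopologicalSpace.SeparableSpace F]
    (hΦ : ∀ x y, Φ (prodVec x y) = smulVec (c.reading x) y) (hA : IsSelfAdjoint A)
    (hV : IsUnitaryGroupOf A V) (hħ : ħ ≠ 0) :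
    (leftGraph (c.testGraph ħ) A.domain).map
      (((interaction Φ hV ħ⁻¹).symm.toLinearEquiv.prodCongr
        (interaction Φ hV ħ⁻¹).symm.toLinearEquiv) :
        HilbertTensor Hc F × HilbertTensor Hc F →ₗ[ℂ] HilbertTensor Hc F × HilbertTensor Hc F) ≤
      (tensorOp (c.hamiltonian ħ) (idOp F) + tensorOp (idOp Hc) A).graph := by
  rw [Submodule.map_le_iff_le_comap, leftGraph, Submodule.span_le]
  rintro _ ⟨q, hq, y, hy, rfl⟩
  let L : Hc →ₗ[ℂ] HilbertTensor Hc F :=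
    (interaction Φ hV ħ⁻¹).symm.toLinearEquiv.toLinearMap ∘ₗ (prodVecLeft y).toLinearMap
  have hL : ∀ x, L x = interaction Φ hV (-ħ⁻¹) (prodVec x y) := fun x =>
    interaction_symm hΦ hA hV ħ⁻¹ (prodVec x y)
  -- For fixed `y` the claim is linear in the clock pair, so it need only be checked on the test
  -- functions spanning `c.testGraph ħ`.
  suffices c.testGraph ħ ≤
      (tensorOp (c.hamiltonian ħ) (idOp F) + tensorOp (idOp Hc) A).graph.comap (L.prodMap L) from
    this hq
  rw [IdealClock.testGraph, testGraph, Submodule.map_span, Submodule.span_le]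
  rintro _ ⟨_, ⟨φ, h, hs, rfl⟩, rfl⟩
  change (L (c.testState h hs), L (c.reading.symm (-(Complex.I * ħ) • testVec _ _ _))) ∈
    LinearPMap.graph _
  have hp := A.mem_graph ⟨y, hy⟩
  have h1 := interaction_mem_graph_hamiltonian hΦ hA hV hħ h hs hp
  have h2 := interaction_mem_graph_idOp_tensorOp hΦ hA hV (-ħ⁻¹) (c.testState h hs) hp
  have h3 := add_mem_graph h1 h2
  rw [sub_add_cancel] at h3
  rw [map_smul, map_smul, hL, hL]
  exact h3

/-- The interaction unitary removes the Hamiltonian of the rest of the world. -/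
theorem conj_interaction_nonInteracting [CompleteSpace Hc] [CompleteSpace F]
    [TopologicalSpace.SeparableSpace F]
    (hΦ : ∀ x y, Φ (prodVec x y) = smulVec (c.reading x) y) (hA : IsSelfAdjoint A)
    (hV : IsUnitaryGroupOf A V) (hħ : ħ ≠ 0) :
    conj (interaction Φ hV ħ⁻¹) (nonInteracting (c.hamiltonian ħ) A) =
      tensorOp (c.hamiltonian ħ) (idOp F) := by
  have h : nonInteracting (c.hamiltonian ħ) A =
      conj (interaction Φ hV ħ⁻¹).symm (tensorOp (c.hamiltonian ħ) (idOp F)) := by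
    refine closure_eq_of_le_graph (noninteracting_sum_isFormalAdjoint hA hħ)
      (leftGraph_map_le_graph hΦ hA hV hħ) ?_ ?_
    · rw [topologicalClosure_map, adjoint_map, leftGraph_topologicalClosure
        (c.testGraph_topologicalClosure hħ) hA.dense_domain]
    · rw [adjoint_map, graph_conj, c.tensorOp_hamiltonian_idOp_graph hħ hA.dense_domain]
  refine LinearPMap.eq_of_eq_graph ?_
  ext p
  rw [h, mem_graph_conj, mem_graph_conj, LinearIsometryEquiv.symm_symm,
    LinearIsometryEquiv.apply_symm_apply, LinearIsometryEquiv.apply_symm_apply]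

theorem isSelfAdjoint_zero [CompleteSpace F] : IsSelfAdjoint (0 : F →ₗ.[ℂ] F) := by
  have h := ContinuousLinearMap.toPMap_adjoint_eq_adjoint_toPMap_of_dense (0 : F →L[ℂ] F)
    (p := ⊤) dense_univ
  rw [map_zero] at h
  exact h

/-- With zero world Hamiltonian the sum need only agree with `H_c ⊗ I` on a core; this identifies
the total Hamiltonian of the new system. -/
theorem nonInteracting_zero [CompleteSpace Hc] [CompleteSpace F] (hħ : ħ ≠ 0) :
    nonInteracting (c.hamiltonian ħ) (0 : F →ₗ.[ℂ] F) =
      tensorOp (c.hamiltonian ħ) (idOp F) := by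
  have h0 := isSelfAdjoint_zero (F := F)
  have hgr := c.tensorOp_hamiltonian_idOp_graph (F := F) hħ (D := ⊤) dense_univ
  have hcl := leftGraph_topologicalClosure (F := F) (c.testGraph_topologicalClosure hħ) (D := ⊤)
    dense_univ
  refine closure_eq_of_le_graph (noninteracting_sum_isFormalAdjoint h0 hħ)
    (fun p hp => ?_) hcl hgr
  have h1 : (p.1, p.2) ∈ (tensorOp (c.hamiltonian ħ) (idOp F)).graph := by
    rw [hgr, ← hcl]
    exact Submodule.le_topologicalClosure _ hp
  have h2 : (p.1, 0) ∈ (tensorOp (idOp Hc) (0 : F →ₗ.[ℂ] F)).graph := by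
    rw [tensorOp_idOp_graph h0]
    refine mem_rightGraph_adjoint.2 fun x q hq => ?_
    obtain ⟨y, -, hy⟩ := LinearPMap.mem_graph_iff _ |>.1 hq
    have hq2 : q.2 = 0 := hy.symm
    rw [hq2, ← prodVecRight_apply, map_zero, inner_zero_left, inner_zero_right]
  simpa using add_mem_graph h1 h2

end TotalHamiltonian

end PageWootters

end

theorem mainTheorem4 {Hc Hr H : Type*}
    [NormedAddCommGroup Hc] [InnerProductSpace ℂ Hc] [CompleteSpace Hc]
    [NormedAddCommGroup Hr] [InnerProductSpace ℂ Hr] [CompleteSpace Hr]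
    [TopologicalSpace.SeparableSpace Hr]
    [NormedAddCommGroup H] [InnerProductSpace ℂ H] [CompleteSpace H]
    (ħ : ℝ) (hħ : 0 < ħ) (P : PageWootters.PWSystem Hc Hr H) :
    ∃ S : PageWootters.HilbertTensor Hc Hr ≃ₗᵢ[ℂ] PageWootters.HilbertTensor Hc Hr,
      -- `S = exp ((i/ħ) T_c ⊗ H_r)`
      PageWootters.IsExp ħ⁻¹ (PageWootters.tensorOp P.clock.timeOp P.worldHamiltonian) S ∧
      -- `S (H_c ⊗ I + I ⊗ H_r) S⁻¹ = H_c ⊗ I`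
      PageWootters.conj S
          (PageWootters.nonInteracting (P.clock.hamiltonian ħ) P.worldHamiltonian) =
        PageWootters.tensorOp (P.clock.hamiltonian ħ) (PageWootters.idOp Hr) ∧
      -- in the structure `U' = U ∘ S⁻¹` the system is a PW system with zero world Hamiltonian
      ∃ P' : PageWootters.PWSystem Hc Hr H,
        P'.tps = S.symm.trans P.tps ∧
        P'.clock = P.clock ∧
        P'.worldHamiltonian = 0 ∧
        P'.totalHamiltonian ħ = P.totalHamiltonian ħ ∧
        P.totalHamiltonian ħ = PageWootters.conj P'.tps
          (PageWootters.tensorOp (P'.clock.hamiltonian ħ) (PageWootters.idOp Hr)) ∧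
        (P.worldHamiltonian ≠ 0 → P'.tps ≠ P.tps) := by
  open PageWootters in
  obtain ⟨V, hV⟩ := exists_isUnitaryGroupOf P.selfAdjoint
  obtain ⟨Φ, hΦ⟩ := exists_vectorReading (F := Hr) P.clock
  have hconj := conj_interaction_nonInteracting hΦ P.selfAdjoint hV hħ.ne'
  have htotal : P.totalHamiltonian ħ = conj ((interaction Φ hV ħ⁻¹).symm.trans P.tps)
      (tensorOp (P.clock.hamiltonian ħ) (idOp Hr)) := by
    refine LinearPMap.eq_of_eq_graph ?_
    ext p
    rw [PWSystem.totalHamiltonian, ← hconj, mem_graph_conj, mem_graph_conj, mem_graph_conj]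
    simp
  refine ⟨interaction Φ hV ħ⁻¹,
    ⟨_, isUnitaryGroupOf_interaction hΦ P.selfAdjoint hV, rfl⟩, hconj,
    ⟨(interaction Φ hV ħ⁻¹).symm.trans P.tps, P.clock, 0, isSelfAdjoint_zero⟩, rfl, rfl, rfl,
    ?_, htotal, fun hne heq => hne ?_⟩
  · rw [htotal, PWSystem.totalHamiltonian, nonInteracting_zero hħ.ne']
  · refine eq_zero_of_interaction_eq_refl hΦ hV (inv_ne_zero hħ.ne') fun u => ?_
    -- Evaluating `U ∘ S⁻¹ = U` at `S u` and cancelling `U` gives `S⁻¹ (S u) = S u`, that is `S u =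
    -- u`.
    have h1 := P.tps.injective (DFunLike.congr_fun heq (interaction Φ hV ħ⁻¹ u))
    exact h1.symm.trans ((interaction Φ hV ħ⁻¹).symm_apply_apply u)
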